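/- Let $n\ge 1$ be an integer, let $s>t\ge 0$ and $p\in\bigl(1,\frac{n}{s-t}\bigr)$ be real, and set $p^*=\frac{np}{n-(s-t)p}$. For measurable $f:\mathbb R^n\to\mathbb C$ let $$[f]_{s,p}=\Bigl(\int_{\mathbb R^n}\int_{\mathbb R^n}\frac{|f(x)-f(y)|^p}{|x-y|^{n+sp}}\,dx\,dy\Bigr)^{1/p}\in[0,\infty].$$ For a Schwartz function $\varphi$ let $(-\Delta)^{t/2}\varphi$ be the inverse Fourier transform of $(2\pi|\xi|)^t\,\hat\varphi(\xi)$, where $\hat\varphi(\xi)=\int_{\mathbb R^n} e^{-2\pi i x\cdot\xi}\varphi(x)\,dx$. Then there is a constant $C<\infty$, depending only on $n,s,t,p$, such that (i) for every Schwartz function $f:\mathbb R^n\to\mathbb C$, $$\|(-\Delta)^{t/2}f\|_{L^{p^*}(\mathbb R^n)}\le C\,[f]_{s,p};$$ (ii) more generally, for every measurable $f:\mathbb R^n\to\mathbb C$ with $\int_{\mathbb R^n}|f(x)|(1+|x|)^{-n-t}\,dx<\infty$ and $[f]_{s,p}<\infty$, the distribution $(-\Delta)^{t/2}f$, given by $\varphi\mapsto\int_{\mathbb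 R^n} f\,(-\Delta)^{t/2}\varphi\,dx$ on Schwartz functions $\varphi$ (the integrand being integrable), is represented by a function $g\in L^{p^*}(\mathbb R^n)$, and $\|g\|_{L^{p^*}(\mathbb R^n)}\le C\,[f]_{s,p}$. -/

import Mathlib

open MeasureTheory FourierTransform SchwartzMap
open scoped NNReal ENNReal

/-- The fractional Laplacian `(-Δ)^{t/2} φ` of a Schwartz function on `ℝⁿ`: the Fourier multiplier
with symbol `(2π|ξ|)^t`, where `𝓕 φ ξ = ∫ exp(-2πi⟨x, ξ⟩) φ x dx`. -/
noncomputable def fracLaplacian {n : ℕ} (t : ℝ) (φ : 𝓢(EuclideanSpace ℝ (Fin n), ℂ)) :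
    EuclideanSpace ℝ (Fin n) → ℂ :=
  𝓕⁻ (fun ξ : EuclideanSpace ℝ (Fin n) => (((2 * Real.pi * ‖ξ‖) ^ t : ℝ) : ℂ) * 𝓕 φ ξ)

/-- The weighted space `L¹(ℝⁿ, (1 + |x|)^{-n-t} dx)`, the natural domain of the distributional
`(-Δ)^{t/2}`: for Schwartz `φ` the function `(-Δ)^{t/2} φ` decays (at least) like `|x|^{-n-t}`. -/
def InFracDomain {n : ℕ} (t : ℝ) (f : EuclideanSpace ℝ (Fin n) → ℂ) : Prop :=
  Integrable (fun x => (((1 + ‖x‖) ^ (-((n : ℝ) + t)) : ℝ) : ℂ) * f x)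

/-- `(-Δ)^{t/2} f = g` in the sense of tempered distributions: the operator is moved onto the test
function (its symbol is even, so it is its own transpose). -/
def IsWeakFracLaplacian {n : ℕ} (t : ℝ) (f g : EuclideanSpace ℝ (Fin n) → ℂ) : Prop :=
  LocallyIntegrable g ∧
    ∀ φ : 𝓢(EuclideanSpace ℝ (Fin n), ℂ),
      Integrable (fun x => f x * fracLaplacian t φ x) ∧
      Integrable (fun x => g x * φ x) ∧
      ∫ x, f x * fracLaplacian t φ x = ∫ x, g x * φ x

/-- The Gagliardo seminorm `(∬ |f(x) - f(y)|^p / |x - y|^{n + sp} dx dy)^{1/p} ∈ [0, ∞]`. -/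
noncomputable def gagliardo {n : ℕ} (s p : ℝ) (f : EuclideanSpace ℝ (Fin n) → ℂ) : ℝ≥0∞ :=
  (∫⁻ y, ∫⁻ x, ‖f x - f y‖ₑ ^ p / ‖x - y‖ₑ ^ ((n : ℝ) + s * p)) ^ (1 / p)

/-!
# The fractional Sobolev inequality for `(-Δ)^{t/2}`

The operator is written as a superposition of averages over all scales, and the averages are
estimated by a Hedberg-type argument in the scale variable; no maximal function, no
Littlewood–Paley theory and no embedding between function spaces is needed.

Let `Ψ(ξ) = |ξ|^{2k} b(|ξ|²)` with a bump function `b` supported near `1` and `2k > t`, and let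
`ψ` be its inverse Fourier transform, a Schwartz function of mean zero. With
`ψ_r(z) = r^{-n} ψ(z / r)`, the scaling `∫ r^{-t} Ψ(rξ) dr/r = c |ξ|^t` gives the Calderón formula
`(-Δ)^{t/2} φ = c' ∫ r^{-t} (ψ_r * φ) dr/r` (`integral_exp_mul_integral_dilate`,
`fracLaplacian_eq`). For Schwartz `φ` this integral converges absolutely and is bounded by a
multiple of `(1 + |x|)^{-n-t}` (`exists_lintegral_exp_mul_integral_dilate_le`): small scales gain
`r^{2k}`, large scales are bumps of height `r^{-n}` and width `r`. Hence for `f` in the weighted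
`L¹` space Fubini's theorem moves the formula onto `f` (`integral_mul_integral_scales`), and the
candidate for `(-Δ)^{t/2} f` is `g(y) = c' ∫ r^{-t} F_r(y) dr/r`, where `F_r` is the average
`dilateAvg` of `f`.

As `ψ` has mean zero, Jensen's inequality bounds `|F_r(y)|^p` by the average of `|f(x) - c|^p` for
every constant `c`. Taking `c = f(y)` and integrating over all scales gives
`∫ r^{-sp} |F_r(y)|^p dr/r ≤ C G(y)`, where `∫ G = [f]^p`
(`exists_lintegral_enorm_dilateAvg_rpow_le`); taking `c = f(z)` and averaging over
`z ∈ B(y, r)` gives `|F_r(y)|^p ≤ C r^{sp-n} [f]^p` (`exists_enorm_dilateAvg_rpow_le`). Using the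
first bound below a scale `R`, the second above it, and optimising in `R`, one finds
`|g(y)|^{p*} ≤ C G(y) [f]^{p* - p}` (`exists_lintegral_exp_mul_rpow_le`), which is integrated in
`y`. The bound for Schwartz `f` follows because the weak fractional Laplacian then agrees with the
Fourier multiplier.

Throughout, the scale is `r = exp u` and `dr/r` is Lebesgue measure `du`.
-/

section FractionalSobolev

open Real Set Module

set_option linter.unusedSectionVars false

/-! ### Exponential integrals over scales -/

section Scales

theorem integrable_exp_neg_mul_mul_min {a b : ℝ} (ha : 0 < a) (hab : a < b) :
    Integrable (fun u : ℝ => exp (-a * u) * min 1 (exp (b * u))) := by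
  have hm : Continuous (fun u : ℝ => exp (-a * u) * min 1 (exp (b * u))) := by fun_prop
  rw [← integrableOn_univ, ← Iic_union_Ioi (a := (0 : ℝ)), integrableOn_union]
  constructor
  · refine (integrableOn_exp_mul_Iic (a := b - a) (by linarith) 0).mono'
      hm.aestronglyMeasurable.restrict (Filter.Eventually.of_forall fun u => ?_)
    rw [norm_of_nonneg (by positivity), show (b - a) * u = -a * u + b * u by ring, exp_add]
    gcongr
    exact min_le_right _ _
  · refine (integrableOn_exp_mul_Ioi (a := -a) (by linarith) 0).mono'
      hm.aestronglyMeasurable.restrict (Filter.Eventually.of_forall fun u => ?_)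
    rw [norm_of_nonneg (by positivity)]
    exact mul_le_of_le_one_right (by positivity) (min_le_left _ _)

/-- The scale integral `∫ r⁻ᵃ min(1, (X / r)⁻ᵇ) dr/r` is a multiple of `X⁻ᵃ`, by translation
invariance in `u = log r`. -/
theorem exists_lintegral_exp_mul_min_le {a b : ℝ} (ha : 0 < a) (hab : a < b) :
    ∃ C : ℝ≥0, ∀ X : ℝ, 0 < X →
      ∫⁻ u : ℝ, ENNReal.ofReal (exp (-a * u) * min 1 ((X * exp (-u)) ^ (-b))) ≤
        C * ENNReal.ofReal (X ^ (-a)) := by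
  refine ⟨(∫⁻ u : ℝ, ENNReal.ofReal (exp (-a * u) * min 1 (exp (b * u)))).toNNReal,
    fun X hX => ?_⟩
  have hfin : ∫⁻ u : ℝ, ENNReal.ofReal (exp (-a * u) * min 1 (exp (b * u))) ≠ ∞ :=
    (integrable_exp_neg_mul_mul_min ha hab).lintegral_lt_top.ne
  rw [ENNReal.coe_toNNReal hfin]
  obtain ⟨v, rfl⟩ : ∃ v, exp v = X := ⟨log X, exp_log hX⟩
  rw [← lintegral_add_right_eq_self _ v, ← lintegral_mul_const _ (by fun_prop)]
  refine lintegral_mono fun u => ?_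
  rw [← ENNReal.ofReal_mul (by positivity), ← exp_add, ← exp_mul, ← exp_mul,
    mul_right_comm, ← exp_add, show (v + -(u + v)) * -b = b * u by ring,
    show -a * (u + v) = -a * u + v * -a by ring]

end Scales

/-! ### Dilates of a kernel -/

section Kernel

variable {V : Type*} [NormedAddCommGroup V] [InnerProductSpace ℝ V] [FiniteDimensional ℝ V]
  [MeasurableSpace V] [BorelSpace V]

/-- The `L¹`-normalised dilate of `ψ` at scale `r = exp u`, that is `r⁻ᵈ ψ (z / r)`. Scales are
parametrised by their logarithm, so that the scale-invariant measure `dr / r` is the Lebesgue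
measure `du`. -/
noncomputable def dilate (ψ : V → ℂ) (u : ℝ) (z : V) : ℂ :=
  (exp (-(finrank ℝ V * u)) : ℝ) * ψ (exp (-u) • z)

theorem norm_dilate (ψ : V → ℂ) (u : ℝ) (z : V) :
    ‖dilate ψ u z‖ = exp (-(finrank ℝ V * u)) * ‖ψ (exp (-u) • z)‖ := by
  rw [dilate, norm_mul, Complex.norm_real, norm_of_nonneg (exp_pos _).le]

theorem continuous_dilate {ψ : V → ℂ} (hψ : Continuous ψ) :
    Continuous (fun q : ℝ × V => dilate ψ q.1 q.2) := by
  unfold dilate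
  fun_prop

theorem continuous_dilate_right {ψ : V → ℂ} (hψ : Continuous ψ) (u : ℝ) :
    Continuous (dilate ψ u) := by
  unfold dilate
  fun_prop

theorem integral_dilate {F : Type*} [NormedAddCommGroup F] [NormedSpace ℝ F] (g : V → F) (u : ℝ) :
    ∫ z, exp (-(finrank ℝ V * u)) • g (exp (-u) • z) = ∫ z, g z := by
  rw [integral_smul, Measure.integral_comp_smul_of_nonneg _ _ _ (hR := (exp_pos _).le), smul_smul,
    ← exp_nat_mul, ← exp_neg, ← exp_add]
  simp

theorem integrable_dilate {ψ : V → ℂ} (hψ : Integrable ψ) (u : ℝ) : Integrable (dilate ψ u) :=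
  (hψ.comp_smul (exp_pos (-u)).ne').const_mul _

theorem integral_norm_dilate (ψ : V → ℂ) (u : ℝ) : ∫ z, ‖dilate ψ u z‖ = ∫ z, ‖ψ z‖ := by
  simp_rw [norm_dilate]
  exact integral_dilate (fun z => ‖ψ z‖) u

theorem exists_norm_le_schwartz (ψ : 𝓢(V, ℂ)) (N : ℕ) :
    ∃ C, 0 < C ∧ ∀ z, ‖ψ z‖ * (1 + ‖z‖) ^ N ≤ C := by
  refine ⟨2 ^ N * (Finset.Iic (N, 0)).sup (fun m => SchwartzMap.seminorm ℝ m.1 m.2) ψ + 1,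
    by positivity, fun z => ?_⟩
  have := SchwartzMap.one_add_le_sup_seminorm_apply (𝕜 := ℝ) (m := (N, 0)) (k := N) (n := 0)
    le_rfl le_rfl ψ z
  simp only [norm_iteratedFDeriv_zero] at this
  linarith [mul_comm ‖ψ z‖ ((1 + ‖z‖) ^ N)]

theorem integrable_norm_mul_one_add_norm_pow (ψ : 𝓢(V, ℂ)) (N : ℕ) :
    Integrable (fun z => ‖ψ z‖ * (1 + ‖z‖) ^ N) := by
  obtain ⟨C, hC, h⟩ := exists_norm_le_schwartz ψ (N + (finrank ℝ V + 1))
  have hi := (integrable_one_add_norm (E := V) (μ := volume) (r := (finrank ℝ V + 1 : ℕ))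
    (by push_cast; linarith)).const_mul C
  have hc : Continuous (fun z => ‖ψ z‖ * (1 + ‖z‖) ^ N) := by have := ψ.continuous; fun_prop
  refine hi.mono' hc.aestronglyMeasurable
    (Filter.Eventually.of_forall fun z => ?_)
  rw [norm_of_nonneg (by positivity), rpow_neg (by positivity), rpow_natCast, ← div_eq_mul_inv,
    le_div_iff₀ (by positivity), mul_assoc, ← pow_add]
  exact h z

/-- Peetre's inequality. -/
theorem one_add_mul_norm_le {c : ℝ} (hc : 0 ≤ c) (x y : V) :
    1 + c * ‖x‖ ≤ (1 + c * ‖x - y‖) * (1 + c * ‖y‖) := by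
  have h : ‖x‖ ≤ ‖x - y‖ + ‖y‖ := by simpa using norm_add_le (x - y) y
  have h1 : 0 ≤ (c * ‖x - y‖) * (c * ‖y‖) := by positivity
  nlinarith [mul_le_mul_of_nonneg_left h hc]

/-- At scales at most `1`, averages of a Schwartz function decay rapidly, uniformly in the scale. -/
theorem exists_norm_integral_dilate_le_of_nonpos (θ φ : 𝓢(V, ℂ)) (N : ℕ) :
    ∃ C, 0 < C ∧ ∀ u ≤ 0, ∀ x,
      ‖∫ y, dilate θ u (x - y) * φ y‖ ≤ C * ((1 + ‖x‖) ^ N)⁻¹ := by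
  obtain ⟨C, hC, h⟩ := exists_norm_le_schwartz φ N
  set I := ∫ z, ‖θ z‖ * (1 + ‖z‖) ^ N with hI
  have hI0 : 0 ≤ I := integral_nonneg fun z => by positivity
  refine ⟨C * (I + 1), by positivity, fun u hu x => ?_⟩
  have hg := integrable_norm_mul_one_add_norm_pow θ N
  have hd : Integrable (fun z => exp (-(finrank ℝ V * u)) •
      (‖θ (exp (-u) • z)‖ * (1 + ‖exp (-u) • z‖) ^ N)) :=
    (hg.comp_smul (exp_pos (-u)).ne').const_mul _
  have hmono : ‖∫ y, dilate θ u (x - y) * φ y‖ ≤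
      ∫ y, (exp (-(finrank ℝ V * u)) •
      (‖θ (exp (-u) • (x - y))‖ * (1 + ‖exp (-u) • (x - y)‖) ^ N)) * (C * ((1 + ‖x‖) ^ N)⁻¹) := by
    refine norm_integral_le_of_norm_le ((hd.comp_sub_left x).mul_const _)
      (Filter.Eventually.of_forall fun y => ?_)
    have h1 : ‖φ y‖ ≤ C * ((1 + ‖y‖) ^ N)⁻¹ := by
      rw [← div_eq_mul_inv, le_div_iff₀ (by positivity)]; exact h y
    have h2 : 1 + ‖x‖ ≤ (1 + ‖exp (-u) • (x - y)‖) * (1 + ‖y‖) := by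
      have := one_add_mul_norm_le (zero_le_one) x y
      simp only [one_mul] at this
      refine this.trans ?_
      gcongr
      rw [norm_smul, norm_of_nonneg (exp_pos _).le]
      exact le_mul_of_one_le_left (norm_nonneg _) (one_le_exp (by linarith))
    have h3 : ((1 + ‖y‖) ^ N)⁻¹ ≤ (1 + ‖exp (-u) • (x - y)‖) ^ N * ((1 + ‖x‖) ^ N)⁻¹ := by
      rw [← div_eq_mul_inv, inv_le_iff_one_le_mul₀ (by positivity), div_mul_eq_mul_div,
        one_le_div (by positivity), ← mul_pow]
      gcongr
    rw [norm_mul, norm_dilate, smul_eq_mul]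
    calc _ ≤ exp (-(finrank ℝ V * u)) * ‖θ (exp (-u) • (x - y))‖ *
        (C * ((1 + ‖exp (-u) • (x - y)‖) ^ N * ((1 + ‖x‖) ^ N)⁻¹)) := by
          gcongr; exact h1.trans (by gcongr)
      _ = _ := by ring
  refine hmono.trans ?_
  rw [integral_mul_const, integral_sub_left_eq_self (fun z => exp (-(finrank ℝ V * u)) •
      (‖θ (exp (-u) • z)‖ * (1 + ‖exp (-u) • z‖) ^ N)),
    integral_dilate (fun z => ‖θ z‖ * (1 + ‖z‖) ^ N) u, ← hI, ← mul_assoc, mul_comm I]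
  gcongr
  linarith

/-- At scales `r` at least `1`, averages of a Schwartz function are bounded by a bump of width
`r` and height `r⁻ᵈ`. -/
theorem exists_norm_integral_dilate_le_of_nonneg (θ φ : 𝓢(V, ℂ)) (N : ℕ) :
    ∃ C, 0 < C ∧ ∀ u, 0 ≤ u → ∀ x,
      ‖∫ y, dilate θ u (x - y) * φ y‖ ≤
        C * (exp (-(finrank ℝ V * u)) * ((1 + exp (-u) * ‖x‖) ^ N)⁻¹) := by
  obtain ⟨C, hC, h⟩ := exists_norm_le_schwartz θ N
  set I := ∫ z, ‖φ z‖ * (1 + ‖z‖) ^ N with hI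
  have hI0 : 0 ≤ I := integral_nonneg fun z => by positivity
  refine ⟨C * (I + 1), by positivity, fun u hu x => ?_⟩
  have hg := integrable_norm_mul_one_add_norm_pow φ N
  have hmono : ‖∫ y, dilate θ u (x - y) * φ y‖ ≤
      ∫ y, (‖φ y‖ * (1 + ‖y‖) ^ N) *
        (C * (exp (-(finrank ℝ V * u)) * ((1 + exp (-u) * ‖x‖) ^ N)⁻¹)) := by
    refine norm_integral_le_of_norm_le (hg.mul_const _)
      (Filter.Eventually.of_forall fun y => ?_)
    have h1 : ‖θ (exp (-u) • (x - y))‖ ≤ C * ((1 + exp (-u) * ‖x - y‖) ^ N)⁻¹ := by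
      rw [← div_eq_mul_inv, le_div_iff₀ (by positivity)]
      have := h (exp (-u) • (x - y))
      rwa [norm_smul, norm_of_nonneg (exp_pos _).le] at this
    have h2 : 1 + exp (-u) * ‖x‖ ≤ (1 + exp (-u) * ‖x - y‖) * (1 + ‖y‖) := by
      refine (one_add_mul_norm_le (exp_pos _).le x y).trans ?_
      gcongr
      exact mul_le_of_le_one_left (norm_nonneg _) (exp_le_one_iff.2 (by linarith))
    have h3 : ((1 + exp (-u) * ‖x - y‖) ^ N)⁻¹ ≤
        (1 + ‖y‖) ^ N * ((1 + exp (-u) * ‖x‖) ^ N)⁻¹ := by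
      rw [← div_eq_mul_inv, inv_le_iff_one_le_mul₀ (by positivity), div_mul_eq_mul_div,
        one_le_div (by positivity), ← mul_pow, mul_comm (1 + ‖y‖)]
      gcongr
    rw [norm_mul, norm_dilate]
    calc _ ≤ exp (-(finrank ℝ V * u)) *
        (C * ((1 + ‖y‖) ^ N * ((1 + exp (-u) * ‖x‖) ^ N)⁻¹)) * ‖φ y‖ := by
          gcongr; exact h1.trans (by gcongr)
      _ = _ := by ring
  refine hmono.trans ?_
  rw [integral_mul_const, ← hI, ← mul_assoc, mul_comm I]
  gcongr
  linarith

end Kernel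

/-! ### The Calderón formula -/

section Multiplier

/-- A bump function on the line, equal to `1` near `1` and supported in `[1/2, 3/2]`. -/
noncomputable def bumpOne : ContDiffBump (1 : ℝ) where
  rIn := 1 / 4
  rOut := 1 / 2
  rIn_pos := by norm_num
  rIn_lt_rOut := by norm_num

theorem continuous_exp_mul_bumpOne (k : ℕ) (t : ℝ) :
    Continuous fun u : ℝ => exp (-t * u) * (((exp u) ^ 2) ^ k * bumpOne ((exp u) ^ 2)) := by
  have := bumpOne.continuous
  fun_prop

theorem hasCompactSupport_exp_mul_bumpOne (k : ℕ) (t : ℝ) :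
    HasCompactSupport
      fun u : ℝ => exp (-t * u) * (((exp u) ^ 2) ^ k * bumpOne ((exp u) ^ 2)) := by
  refine HasCompactSupport.intro (isCompact_Icc (a := (-1 : ℝ)) (b := 1)) fun u hu => ?_
  have : bumpOne ((exp u) ^ 2) = 0 := by
    refine bumpOne.zero_of_le_dist ?_
    change (1 / 2 : ℝ) ≤ _
    rw [← exp_nat_mul, Real.dist_eq]
    rw [mem_Icc, not_and_or, not_le, not_le] at hu
    push_cast
    rcases hu with hu | hu
    · have h1 : exp (2 * u) ≤ exp (-1) := exp_le_exp.2 (by linarith)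
      have h2 : exp (-1 : ℝ) < 1 / 2 := by
        rw [exp_neg, inv_lt_comm₀ (exp_pos _) (by norm_num)]
        have := exp_one_gt_d9
        norm_num; linarith
      rw [abs_sub_comm, le_abs]; left; linarith
    · have := add_one_le_exp (2 * u)
      rw [le_abs]; left; linarith
  simp [this]

/-- The constant `∫ r^{2k-t} b(r²) dr/r` of the Calderón reproducing formula. -/
noncomputable def calderonConst (k : ℕ) (t : ℝ) : ℝ :=
  ∫ u : ℝ, exp (-t * u) * (((exp u) ^ 2) ^ k * bumpOne ((exp u) ^ 2))

theorem integrable_exp_mul_bumpOne (k : ℕ) (t : ℝ) :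
    Integrable fun u : ℝ => exp (-t * u) * (((exp u) ^ 2) ^ k * bumpOne ((exp u) ^ 2)) :=
  (continuous_exp_mul_bumpOne k t).integrable_of_hasCompactSupport
    (hasCompactSupport_exp_mul_bumpOne k t)

theorem calderonConst_pos (k : ℕ) (t : ℝ) : 0 < calderonConst k t := by
  refine (continuous_exp_mul_bumpOne k t).integral_pos_of_hasCompactSupport_nonneg_nonzero
    (hasCompactSupport_exp_mul_bumpOne k t) (fun u => ?_) (x := 0) ?_
  · have := bumpOne.nonneg (x := (exp u) ^ 2)
    positivity
  · have : bumpOne (1 : ℝ) = 1 := bumpOne.one_of_mem_closedBall (by simp [bumpOne])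
    simp [this]

variable {V : Type*} [NormedAddCommGroup V] [InnerProductSpace ℝ V] [FiniteDimensional ℝ V]
  [MeasurableSpace V] [BorelSpace V]

variable (V) in
/-- The annular cutoff `b(|ξ|²)` as a Schwartz function. -/
noncomputable def annulus : 𝓢(V, ℂ) :=
  HasCompactSupport.toSchwartzMap (f := fun ξ : V => ((bumpOne (‖ξ‖ ^ 2) : ℝ) : ℂ))
    (by
      refine HasCompactSupport.intro (isCompact_closedBall (0 : V) 2) fun ξ hξ => ?_
      rw [mem_closedBall_zero_iff, not_le] at hξ
      have : bumpOne (‖ξ‖ ^ 2) = 0 := by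
        refine bumpOne.zero_of_le_dist ?_
        change (1 / 2 : ℝ) ≤ _
        rw [Real.dist_eq, le_abs]; left; nlinarith
      simp [this])
    (Complex.ofRealCLM.contDiff.comp (bumpOne.contDiff.comp (contDiff_norm_sq ℝ)))

/-- Multiplication of a Schwartz function by `|ξ|^{2k}`. -/
noncomputable def mulNormSqPow (k : ℕ) (φ : 𝓢(V, ℂ)) : 𝓢(V, ℂ) :=
  SchwartzMap.smulLeftCLM ℂ (fun ξ : V => (‖ξ‖ ^ 2) ^ k) φ

theorem mulNormSqPow_apply (k : ℕ) (φ : 𝓢(V, ℂ)) (ξ : V) :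
    mulNormSqPow k φ ξ = (((‖ξ‖ ^ 2) ^ k : ℝ) : ℂ) * φ ξ := by
  rw [mulNormSqPow, SchwartzMap.smulLeftCLM_apply_apply
    (g := fun ξ : V => (‖ξ‖ ^ 2) ^ k) (by fun_prop), Complex.real_smul]

theorem annulus_apply (ξ : V) : annulus V ξ = ((bumpOne (‖ξ‖ ^ 2) : ℝ) : ℂ) := rfl

theorem mulNormSqPow_annulus_apply (k : ℕ) (ξ : V) :
    mulNormSqPow k (annulus V) ξ = (((‖ξ‖ ^ 2) ^ k * bumpOne (‖ξ‖ ^ 2) : ℝ) : ℂ) := by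
  rw [mulNormSqPow_apply, annulus_apply, Complex.ofReal_mul]

/-- The continuous Calderón formula on the frequency side. -/
theorem hasIntegral_calderon (k : ℕ) (t : ℝ) {ξ : V} (hξ : ξ ≠ 0) :
    Integrable (fun u : ℝ => exp (-t * u) *
        ((‖exp u • ξ‖ ^ 2) ^ k * bumpOne (‖exp u • ξ‖ ^ 2))) ∧
      ∫ u : ℝ, exp (-t * u) * ((‖exp u • ξ‖ ^ 2) ^ k * bumpOne (‖exp u • ξ‖ ^ 2)) =
        ‖ξ‖ ^ t * calderonConst k t := by
  have hpos : 0 < ‖ξ‖ := norm_pos_iff.2 hξ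
  have key : (fun u : ℝ => exp (-t * u) *
        ((‖exp u • ξ‖ ^ 2) ^ k * bumpOne (‖exp u • ξ‖ ^ 2))) = fun u : ℝ => ‖ξ‖ ^ t *
        (exp (-t * (u + log ‖ξ‖)) * (((exp (u + log ‖ξ‖)) ^ 2) ^ k *
          bumpOne ((exp (u + log ‖ξ‖)) ^ 2))) := by
    funext u
    rw [norm_smul, norm_of_nonneg (exp_pos u).le, exp_add u, exp_log hpos, ← mul_assoc (‖ξ‖ ^ t),
      rpow_def_of_pos hpos, ← exp_add]
    congr 2
    ring
  rw [key]
  refine ⟨((integrable_exp_mul_bumpOne k t).comp_add_right (log ‖ξ‖)).const_mul _, ?_⟩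
  rw [integral_const_mul, integral_add_right_eq_self
    (fun u : ℝ => exp (-t * u) * (((exp u) ^ 2) ^ k * bumpOne ((exp u) ^ 2)))]
  rfl

theorem dilate_fourierInv (Ψ : 𝓢(V, ℂ)) (u : ℝ) (z : V) :
    dilate (𝓕⁻ Ψ : 𝓢(V, ℂ)) u z = 𝓕⁻ (fun ξ : V => Ψ (exp u • ξ)) z := by
  rw [dilate, SchwartzMap.fourierInv_coe, Real.fourierInv_eq, Real.fourierInv_eq]
  have h := Measure.integral_comp_smul_of_nonneg (volume : Measure V)
    (fun η : V => (𝐞 (inner ℝ η (exp (-u) • z)) : Circle) • Ψ η) (exp u) (hR := (exp_pos _).le)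
  simp only [inner_smul_left, inner_smul_right, ← mul_assoc] at h ⊢
  simp only [conj_trivial, ← exp_add, neg_add_cancel, exp_zero, one_mul] at h
  rw [h, ← exp_nat_mul, ← exp_neg, Complex.real_smul]

/-- Convolution with a dilate is a Fourier multiplier. -/
theorem integral_dilate_fourierInv_mul (Ψ φ : 𝓢(V, ℂ)) (u : ℝ) (x : V) :
    ∫ y, dilate (𝓕⁻ Ψ : 𝓢(V, ℂ)) u (x - y) * φ y =
      𝓕⁻ (fun ξ : V => Ψ (exp u • ξ) * 𝓕 φ ξ) x := by
  have hi : Integrable (fun ξ : V => (𝐞 (inner ℝ ξ x) : Circle) • Ψ (exp u • ξ)) := by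
    have := (Real.fourierIntegral_convergent_iff (μ := volume) (-x)).2
      (Ψ.integrable.comp_smul (exp_pos u).ne')
    simpa using this
  have h := VectorFourier.integral_fourierIntegral_smul_eq_flip (μ := (volume : Measure V))
    (ν := (volume : Measure V)) (L := innerₗ V) Real.continuous_fourierChar continuous_inner hi
    φ.integrable
  rw [Real.fourierInv_eq]
  simp only [smul_eq_mul] at h
  calc _ = _ := ?_
    _ = _ := h
    _ = _ := ?_
  · refine integral_congr_ae (Filter.Eventually.of_forall fun y => ?_)
    simp only []
    rw [dilate_fourierInv, Real.fourierInv_eq, VectorFourier.fourierIntegral]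
    congr 2
    funext ξ
    rw [smul_smul, ← AddChar.map_add_eq_mul, innerₗ_apply_apply, inner_sub_right]
    congr 3
    ring
  · refine integral_congr_ae (Filter.Eventually.of_forall fun ξ => ?_)
    simp only [flip_innerₗ, smul_mul_assoc]
    rfl

variable [Nontrivial V]

/-- The Calderón formula: the multiplier `|ξ|^t` is an absolutely convergent superposition
of convolutions with annular kernels. -/
theorem integral_exp_mul_integral_dilate (k : ℕ) {t : ℝ} (ht : 0 ≤ t) (φ : 𝓢(V, ℂ)) (x : V) :
    ∫ u : ℝ, ((exp (-t * u) : ℝ) : ℂ) *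
      ∫ y, dilate (𝓕⁻ (mulNormSqPow k (annulus V)) : 𝓢(V, ℂ)) u (x - y) * φ y =
    calderonConst k t * 𝓕⁻ (fun ξ : V => ((‖ξ‖ ^ t : ℝ) : ℂ) * 𝓕 φ ξ) x := by
  have hne : ∀ᵐ ξ : V, ξ ≠ 0 := by
    simp [ae_iff]
  set m : ℝ → V → ℝ := fun u ξ => exp (-t * u) *
        ((‖exp u • ξ‖ ^ 2) ^ k * bumpOne (‖exp u • ξ‖ ^ 2)) with hm
  have hm0 : ∀ u ξ, 0 ≤ m u ξ := fun u ξ => by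
    have := bumpOne.nonneg (x := ‖exp u • ξ‖ ^ 2)
    simp only [hm]; positivity
  have hmc : Continuous (fun q : ℝ × V => m q.1 q.2) := by
    have := bumpOne.continuous
    simp only [hm]; fun_prop
  set h : V → ℂ := fun ξ => (𝐞 (inner ℝ ξ x) : Circle) • 𝓕 φ ξ with hh
  have hhc : Continuous h := by
    have := (𝓕 φ).continuous
    have := Real.continuous_fourierChar
    simp only [hh]; fun_prop
  have hprod : Integrable (fun q : ℝ × V => (m q.1 q.2 : ℂ) * h q.2) (volume.prod volume) := by
    rw [integrable_prod_iff' (by fun_prop)]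
    refine ⟨hne.mono fun ξ hξ => ?_, ?_⟩
    · exact (hasIntegral_calderon k t hξ).1.ofReal.mul_const (h ξ)
    obtain ⟨N, hN⟩ := exists_nat_ge t
    refine ((integrable_norm_mul_one_add_norm_pow (𝓕 φ) N).mul_const (calderonConst k t)).mono
      (StronglyMeasurable.integral_prod_left (f := fun (u : ℝ) (ξ : V) => ‖(m u ξ : ℂ) * h ξ‖)
        (Continuous.stronglyMeasurable (by unfold Function.uncurry; fun_prop))).aestronglyMeasurable
      (hne.mono fun ξ hξ => ?_)
    have h1 : ∫ u, ‖(m u ξ : ℂ) * h ξ‖ = ‖ξ‖ ^ t * calderonConst k t * ‖𝓕 φ ξ‖ := by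
      rw [← (hasIntegral_calderon k t hξ).2, ← integral_mul_const]
      refine integral_congr_ae (Filter.Eventually.of_forall fun u => ?_)
      simp only [norm_mul, Complex.norm_real, norm_of_nonneg (hm0 u ξ), hh, Circle.norm_smul]
      rfl
    have h2 : ‖ξ‖ ^ t ≤ (1 + ‖ξ‖) ^ N := by
      rw [← rpow_natCast]
      calc ‖ξ‖ ^ t ≤ (1 + ‖ξ‖) ^ t := by gcongr; linarith
        _ ≤ _ := rpow_le_rpow_of_exponent_le (by linarith [norm_nonneg ξ]) hN
    have h3 := (calderonConst_pos k t).le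
    rw [h1, norm_of_nonneg (by positivity), norm_of_nonneg (by positivity)]
    calc _ ≤ (1 + ‖ξ‖) ^ N * calderonConst k t * ‖𝓕 φ ξ‖ := by gcongr
      _ = _ := by ring
  calc _ = ∫ u : ℝ, ∫ ξ : V, (m u ξ : ℂ) * h ξ := by
        refine integral_congr_ae (Filter.Eventually.of_forall fun u => ?_)
        simp only []
        rw [integral_dilate_fourierInv_mul, Real.fourierInv_eq, ← integral_const_mul]
        refine integral_congr_ae (Filter.Eventually.of_forall fun ξ => ?_)
        simp only [mulNormSqPow_annulus_apply, hm, hh, Circle.smul_def, smul_eq_mul]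
        push_cast
        ring
    _ = ∫ ξ : V, ∫ u : ℝ, (m u ξ : ℂ) * h ξ := integral_integral_swap hprod
    _ = _ := by
        rw [Real.fourierInv_eq, ← integral_const_mul]
        refine integral_congr_ae (hne.mono fun ξ hξ => ?_)
        simp only []
        rw [integral_mul_const, integral_complex_ofReal, (hasIntegral_calderon k t hξ).2]
        simp only [hh, Circle.smul_def, smul_eq_mul]
        push_cast
        ring

end Multiplier

/-! ### Decay of the fractional Laplacian of a Schwartz function -/

section Decay

variable {V : Type*} [NormedAddCommGroup V] [InnerProductSpace ℝ V] [FiniteDimensional ℝ V]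
  [MeasurableSpace V] [BorelSpace V]

/-- The vanishing moments of the kernel, transferred to the Schwartz function. -/
theorem integral_dilate_mulNormSqPow_mul (k : ℕ) (φ : 𝓢(V, ℂ)) (u : ℝ) (x : V) :
    ∫ y, dilate (𝓕⁻ (mulNormSqPow k (annulus V)) : 𝓢(V, ℂ)) u (x - y) * φ y =
      ((exp (2 * k * u) : ℝ) : ℂ) * ∫ y, dilate (𝓕⁻ (annulus V) : 𝓢(V, ℂ)) u (x - y) *
        (𝓕⁻ (mulNormSqPow k (𝓕 φ)) : 𝓢(V, ℂ)) y := by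
  rw [integral_dilate_fourierInv_mul, integral_dilate_fourierInv_mul,
    FourierTransform.fourier_fourierInv_eq, Real.fourierInv_eq, Real.fourierInv_eq,
    ← integral_const_mul]
  refine integral_congr_ae (Filter.Eventually.of_forall fun ξ => ?_)
  simp only [mulNormSqPow_apply, Circle.smul_def, smul_eq_mul, norm_smul,
    norm_of_nonneg (exp_pos u).le]
  have : exp (2 * k * u) = ((exp u) ^ 2) ^ k := by
    rw [← exp_nat_mul, ← exp_nat_mul]; push_cast; ring_nf
  rw [this]
  push_cast
  ring

theorem inv_one_add_pow_le_min {c r b : ℝ} (hc : 0 < c) (hr : 0 ≤ r) (hcr : c ≤ 1 + r)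
    {N : ℕ} (hb : b = N) : ((1 + r) ^ N)⁻¹ ≤ min 1 (c ^ (-b)) := by
  refine le_min (inv_le_one_of_one_le₀ (one_le_pow₀ (by linarith))) ?_
  rw [hb, rpow_neg hc.le, rpow_natCast]
  gcongr

/-- The square function defining the fractional Laplacian decays like `|x|^{-d-t}`. -/
theorem exists_lintegral_exp_mul_integral_dilate_le {k : ℕ} {t : ℝ} (ht : 0 ≤ t) (hk : t < 2 * k)
    (hd : 0 < finrank ℝ V) (φ : 𝓢(V, ℂ)) :
    ∃ C : ℝ≥0, ∀ x, ∫⁻ u : ℝ, ‖((exp (-t * u) : ℝ) : ℂ) *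
      ∫ y, dilate (𝓕⁻ (mulNormSqPow k (annulus V)) : 𝓢(V, ℂ)) u (x - y) * φ y‖ₑ ≤
        C * ENNReal.ofReal ((1 + ‖x‖) ^ (-(finrank ℝ V + t))) := by
  have hd' : (0 : ℝ) < finrank ℝ V := Nat.cast_pos.2 hd
  obtain ⟨N, hN⟩ := exists_nat_gt (finrank ℝ V + t)
  obtain ⟨C₁, hC₁, h₁⟩ := exists_norm_integral_dilate_le_of_nonpos
    (𝓕⁻ (annulus V) : 𝓢(V, ℂ)) (𝓕⁻ (mulNormSqPow k (𝓕 φ)) : 𝓢(V, ℂ)) N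
  obtain ⟨C₂, hC₂, h₂⟩ := exists_norm_integral_dilate_le_of_nonneg
    (𝓕⁻ (mulNormSqPow k (annulus V)) : 𝓢(V, ℂ)) φ N
  obtain ⟨C₃, h₃⟩ := exists_lintegral_exp_mul_min_le (a := finrank ℝ V + t) (b := N)
    (by positivity) hN
  have hfin := (integrableOn_exp_mul_Iic (a := 2 * k - t) (by linarith) 0).lintegral_lt_top.ne
  set J := ∫⁻ u in Iic (0 : ℝ), ENNReal.ofReal (exp ((2 * k - t) * u)) with hJ
  refine ⟨C₁.toNNReal * J.toNNReal + C₂.toNNReal * C₃, fun x => ?_⟩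
  have hx : 0 < 1 + ‖x‖ := by positivity
  rw [← lintegral_add_compl _ measurableSet_Iic (A := Iic (0 : ℝ))]
  rw [ENNReal.coe_add, ENNReal.coe_mul, ENNReal.coe_mul, ENNReal.coe_toNNReal hfin, add_mul]
  gcongr ?_ + ?_
  · rw [mul_right_comm, hJ, ← lintegral_const_mul _ (by fun_prop)]
    refine setLIntegral_mono (by fun_prop) fun u hu => ?_
    rw [← ENNReal.ofReal, ← ENNReal.ofReal_mul hC₁.le, ← ENNReal.ofReal_mul (by positivity),
      ← ofReal_norm]
    refine ENNReal.ofReal_le_ofReal ?_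
    rw [integral_dilate_mulNormSqPow_mul, norm_mul, norm_mul, Complex.norm_real, Complex.norm_real,
      norm_of_nonneg (exp_pos _).le, norm_of_nonneg (exp_pos _).le]
    calc _ ≤ exp (-t * u) * (exp (2 * k * u) * (C₁ * ((1 + ‖x‖) ^ N)⁻¹)) := by
          gcongr; exact h₁ u hu x
      _ ≤ exp (-t * u) * (exp (2 * k * u) * (C₁ * (1 + ‖x‖) ^ (-(finrank ℝ V + t)))) := by
          gcongr
          rw [← rpow_natCast, ← rpow_neg hx.le]
          exact rpow_le_rpow_of_exponent_le (by linarith [norm_nonneg x]) (by linarith)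
      _ = _ := by
          rw [show (2 * k - t) * u = -t * u + 2 * k * u by ring, exp_add]; ring
  · rw [mul_assoc]
    refine le_trans ?_ (mul_le_mul_right (h₃ _ hx) _)
    rw [← lintegral_const_mul _ (by fun_prop)]
    refine (setLIntegral_mono (g := fun u => C₂.toNNReal * ENNReal.ofReal
      (exp (-(finrank ℝ V + t) * u) * min 1 (((1 + ‖x‖) * exp (-u)) ^ (-(N : ℝ)))))
      (by fun_prop) fun u hu => ?_).trans (setLIntegral_le_lintegral _ _)
    have hu : 0 < u := by simpa using hu
    rw [← ENNReal.ofReal, ← ENNReal.ofReal_mul hC₂.le, ← ofReal_norm]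
    refine ENNReal.ofReal_le_ofReal ?_
    rw [norm_mul, Complex.norm_real, norm_of_nonneg (exp_pos _).le]
    have h4 : ((1 + exp (-u) * ‖x‖) ^ N)⁻¹ ≤ min 1 (((1 + ‖x‖) * exp (-u)) ^ (-(N : ℝ))) := by
      refine inv_one_add_pow_le_min (by positivity) (by positivity) ?_ rfl
      have : exp (-u) ≤ 1 := exp_le_one_iff.2 (by linarith)
      nlinarith
    calc _ ≤ exp (-t * u) * (C₂ * (exp (-(finrank ℝ V * u)) *
          min 1 (((1 + ‖x‖) * exp (-u)) ^ (-(N : ℝ))))) := by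
          gcongr; exact (h₂ u hu.le x).trans (by gcongr)
      _ = _ := by
          rw [show -(finrank ℝ V + t) * u = -t * u + -(finrank ℝ V * u) by ring, exp_add]; ring

end Decay

/-! ### The Hedberg-type inequality in the scale variable -/

section Hedberg

theorem lintegral_ofReal_exp_Iic {a : ℝ} (ha : 0 < a) (U : ℝ) :
    ∫⁻ u in Iic U, ENNReal.ofReal (exp (a * u)) = ENNReal.ofReal (exp (a * U) / a) := by
  rw [← integral_exp_mul_Iic ha U, ofReal_integral_eq_lintegral_ofReal
    (integrableOn_exp_mul_Iic ha U) (Filter.Eventually.of_forall fun u => (exp_pos _).le)]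

theorem lintegral_ofReal_exp_Ioi {a : ℝ} (ha : 0 < a) (U : ℝ) :
    ∫⁻ u in Ioi U, ENNReal.ofReal (exp (-a * u)) = ENNReal.ofReal (exp (-a * U) / a) := by
  rw [← neg_div_neg_eq, ← integral_exp_mul_Ioi (by linarith : -a < 0) U,
    ofReal_integral_eq_lintegral_ofReal
    (integrableOn_exp_mul_Ioi (by linarith) U)
    (Filter.Eventually.of_forall fun u => (exp_pos _).le)]

theorem ENNReal.ofReal_exp_rpow (x y : ℝ) :
    ENNReal.ofReal (exp x) ^ y = ENNReal.ofReal (exp (x * y)) := by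
  rw [ENNReal.ofReal_rpow_of_pos (exp_pos _), exp_mul]

/-- Splitting the integral over scales at `exp U`: Hölder's inequality at small scales, the
pointwise bound at large scales. -/
theorem lintegral_exp_mul_le_add {d s t p q : ℝ} (hpq : p.HolderConjugate q) (hst : t < s)
    (hpd : (s - t) * p < d) {a : ℝ → ℝ≥0∞} (ha : Measurable a) {B K : ℝ≥0∞}
    (hB : ∫⁻ u, ENNReal.ofReal (exp (-(s * p) * u)) * a u ^ p ≤ B)
    (hK : ∀ u, a u ^ p ≤ K * ENNReal.ofReal (exp ((s * p - d) * u))) (U : ℝ) :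
    ∫⁻ u, ENNReal.ofReal (exp (-t * u)) * a u ≤
      ENNReal.ofReal (((s - t) * q)⁻¹) ^ (1 / q) * (ENNReal.ofReal (exp ((s - t) * U)) * B ^ (1 / p))
      + ENNReal.ofReal ((d / p - (s - t))⁻¹) *
        (ENNReal.ofReal (exp (-(d / p - (s - t)) * U)) * K ^ (1 / p)) := by
  have hp0 := hpq.pos
  have hq0 := hpq.symm.pos
  have hσ : 0 < s - t := by linarith
  have hδ : 0 < d / p - (s - t) := by
    rw [sub_pos, lt_div_iff₀ hp0]; exact hpd
  rw [← lintegral_add_compl _ measurableSet_Iic (A := Iic U), compl_Iic]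
  gcongr ?_ + ?_
  · have h := ENNReal.lintegral_mul_le_Lp_mul_Lq (volume.restrict (Iic U)) hpq
      (f := fun u => ENNReal.ofReal (exp (-s * u)) * a u)
      (g := fun u => ENNReal.ofReal (exp ((s - t) * u))) (by fun_prop) (by fun_prop)
    calc _ = ∫⁻ u in Iic U, ((fun u => ENNReal.ofReal (exp (-s * u)) * a u) *
          fun u => ENNReal.ofReal (exp ((s - t) * u))) u := by
          refine lintegral_congr fun u => ?_
          simp only [Pi.mul_apply]
          rw [mul_right_comm, ← ENNReal.ofReal_mul (exp_pos _).le, ← exp_add]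
          ring_nf
      _ ≤ _ := h
      _ ≤ B ^ (1 / p) * (ENNReal.ofReal (exp ((s - t) * q * U) / ((s - t) * q))) ^ (1 / q) := by
          gcongr
          · refine le_trans (setLIntegral_le_lintegral _ _) (le_trans (le_of_eq ?_) hB)
            refine lintegral_congr fun u => ?_
            rw [ENNReal.mul_rpow_of_nonneg _ _ hp0.le, ENNReal.ofReal_exp_rpow]
            ring_nf
          · rw [← lintegral_ofReal_exp_Iic (by positivity)]
            refine le_of_eq (lintegral_congr fun u => ?_)
            rw [ENNReal.ofReal_exp_rpow]
            ring_nf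
      _ = _ := by
          rw [div_eq_inv_mul (exp _), ENNReal.ofReal_mul (by positivity),
            ENNReal.mul_rpow_of_nonneg _ _ (by positivity), ENNReal.ofReal_exp_rpow,
            show (s - t) * q * U * (1 / q) = (s - t) * U by field_simp]
          ring
  · have h : ∀ u, a u ≤ K ^ (1 / p) * ENNReal.ofReal (exp ((s - d / p) * u)) := fun u => by
      have := ENNReal.rpow_le_rpow (hK u) (by positivity : 0 ≤ 1 / p)
      rw [← ENNReal.rpow_mul, mul_one_div_cancel hp0.ne', ENNReal.rpow_one,
        ENNReal.mul_rpow_of_nonneg _ _ (by positivity), ENNReal.ofReal_exp_rpow] at this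
      rwa [show (s - d / p) * u = (s * p - d) * u * (1 / p) by field_simp]
    calc _ ≤ ∫⁻ u in Ioi U, K ^ (1 / p) * ENNReal.ofReal (exp (-(d / p - (s - t)) * u)) := by
          refine lintegral_mono fun u => ?_
          grw [h u]
          rw [mul_left_comm, ← ENNReal.ofReal_mul (exp_pos _).le, ← exp_add]
          ring_nf
          exact le_rfl
      _ = _ := by
          rw [lintegral_const_mul _ (by fun_prop), lintegral_ofReal_exp_Ioi hδ,
            div_eq_inv_mul (exp _),
            ENNReal.ofReal_mul (by positivity)]
          ring

/-- A Hedberg-type inequality in the scale variable: an `Lᵖ` bound and a pointwise bound over the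
scales interpolate to a bound of the weighted integral over all scales. -/
theorem exists_lintegral_exp_mul_rpow_le {d s t p : ℝ} (hst : t < s) (hp : 1 < p)
    (hpd : (s - t) * p < d) : ∃ C : ℝ≥0, ∀ (a : ℝ → ℝ≥0∞) (B K : ℝ≥0∞), Measurable a →
      ∫⁻ u, ENNReal.ofReal (exp (-(s * p) * u)) * a u ^ p ≤ B →
      (∀ u, a u ^ p ≤ K * ENNReal.ofReal (exp ((s * p - d) * u))) →
      (∫⁻ u, ENNReal.ofReal (exp (-t * u)) * a u) ^ (d * p / (d - (s - t) * p)) ≤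
        C * (B * K ^ ((s - t) * p / (d - (s - t) * p))) := by
  have hpq := Real.HolderConjugate.conjExponent hp
  set q := p.conjExponent
  have hp0 := hpq.pos
  have hq0 := hpq.symm.pos
  have hσ : 0 < s - t := by linarith
  have hδ : 0 < d / p - (s - t) := by
    rw [sub_pos, lt_div_iff₀ hp0]; exact hpd
  have hd : 0 < d := lt_trans (by positivity) hpd
  have hdp : 0 < d - (s - t) * p := by linarith
  have hr : 0 < d * p / (d - (s - t) * p) := by positivity
  have hr' : 0 < (s - t) * p / (d - (s - t) * p) := by positivity
  set c := ENNReal.ofReal (((s - t) * q)⁻¹) ^ (1 / q) + ENNReal.ofReal ((d / p - (s - t))⁻¹) with hc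
  have hcfin : c ≠ ∞ := ENNReal.add_ne_top.2
    ⟨ENNReal.rpow_ne_top_of_nonneg (by positivity) ENNReal.ofReal_ne_top, ENNReal.ofReal_ne_top⟩
  have hcpos : c ≠ 0 := by
    have : 0 < ENNReal.ofReal ((d / p - (s - t))⁻¹) := ENNReal.ofReal_pos.2 (by positivity)
    exact (lt_of_lt_of_le this le_add_self).ne'
  refine ⟨(c ^ (d * p / (d - (s - t) * p))).toNNReal, fun a B K ha hB hK => ?_⟩
  rw [ENNReal.coe_toNNReal (ENNReal.rpow_ne_top_of_nonneg hr.le hcfin)]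
  have hcr : c ^ (d * p / (d - (s - t) * p)) ≠ 0 := by
    simp [ENNReal.rpow_eq_zero_iff, hcpos, hcfin]
  -- If one of the two bounds vanishes, so does `a`.
  have hzero : (∀ᵐ u, a u = 0) →
      (∫⁻ u, ENNReal.ofReal (exp (-t * u)) * a u) ^ (d * p / (d - (s - t) * p)) = 0 := fun h => by
    rw [lintegral_eq_zero_of_ae_eq_zero (h.mono fun u hu => by simp [hu]),
      ENNReal.zero_rpow_of_pos hr]
  rcases eq_or_ne K 0 with hK0 | hK0
  · rw [hzero (Filter.Eventually.of_forall fun u => ?_)]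
    · exact zero_le
    · have := hK u
      simpa [hK0, hp0, hp0.not_gt] using this
  rcases eq_or_ne B 0 with hB0 | hB0
  · rw [hzero]
    · exact zero_le
    · rw [hB0, nonpos_iff_eq_zero, lintegral_eq_zero_iff (by fun_prop)] at hB
      filter_upwards [hB] with u hu
      simpa [exp_pos, hp0, hp0.not_gt, (exp_pos _).not_ge] using hu
  rcases eq_or_ne B ∞ with hB1 | hB1
  · rw [hB1, ENNReal.top_mul (by simp [ENNReal.rpow_eq_zero_iff, hK0, hr'.not_gt]),
      ENNReal.mul_top hcr]
    exact le_top
  rcases eq_or_ne K ∞ with hK1 | hK1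
  · rw [hK1, ENNReal.top_rpow_of_pos hr', ENNReal.mul_top hB0, ENNReal.mul_top hcr]
    exact le_top
  obtain ⟨x, rfl⟩ : ∃ x, ENNReal.ofReal (exp x) = B :=
    ⟨log B.toReal, by rw [exp_log (ENNReal.toReal_pos hB0 hB1), ENNReal.ofReal_toReal hB1]⟩
  obtain ⟨y, rfl⟩ : ∃ y, ENNReal.ofReal (exp y) = K :=
    ⟨log K.toReal, by rw [exp_log (ENNReal.toReal_pos hK0 hK1), ENNReal.ofReal_toReal hK1]⟩
  -- The optimal scale satisfies `exp (d U) = K / B` and balances the two contributions.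
  have h := lintegral_exp_mul_le_add hpq hst hpd ha hB hK ((y - x) / d)
  simp only [ENNReal.ofReal_exp_rpow] at h ⊢
  rw [← ENNReal.ofReal_mul (exp_pos _).le, ← exp_add, ← ENNReal.ofReal_mul (exp_pos _).le,
    ← exp_add] at h
  have e₁ : (x + y * ((s - t) * p / (d - (s - t) * p))) * (d * p / (d - (s - t) * p))⁻¹ =
      (s - t) * ((y - x) / d) + x * (1 / p) := by
    generalize s - t = σ at *
    field_simp
    ring
  have e₂ : -(d / p - (s - t)) * ((y - x) / d) + y * (1 / p) =
      (s - t) * ((y - x) / d) + x * (1 / p) := by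
    field_simp
    ring
  rw [e₂, ← e₁, ← add_mul, ← hc] at h
  refine (ENNReal.rpow_le_rpow h hr.le).trans (le_of_eq ?_)
  rw [ENNReal.mul_rpow_of_nonneg _ _ hr.le, ENNReal.ofReal_exp_rpow,
    ← ENNReal.ofReal_mul (exp_pos _).le, ← exp_add, inv_mul_cancel_right₀ hr.ne']

end Hedberg

/-! ### Averages and the Gagliardo seminorm -/

section Averages

variable {V : Type*} [NormedAddCommGroup V] [InnerProductSpace ℝ V] [FiniteDimensional ℝ V]
  [MeasurableSpace V] [BorelSpace V]

/-- The correlation of `f` with the kernel `ψ` at scale `exp u`. -/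
noncomputable def dilateAvg (ψ f : V → ℂ) (u : ℝ) (y : V) : ℂ :=
  ∫ x, f x * dilate ψ u (x - y)

/-- The inner integral of the Gagliardo seminorm: its integral over `y` is `[f]_{s,p}^p`. -/
noncomputable def gagliardoDensity (s p : ℝ) (f : V → ℂ) (y : V) : ℝ≥0∞ :=
  ∫⁻ x, ‖f x - f y‖ₑ ^ p / ‖x - y‖ₑ ^ ((finrank ℝ V : ℝ) + s * p)

/-- Jensen's inequality for weighted integrals. -/
theorem lintegral_mul_rpow_le {α : Type*} [MeasurableSpace α] {μ : Measure α} {p : ℝ} (hp : 1 < p)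
    {h w : α → ℝ≥0∞} (hh : AEMeasurable h μ) (hw : AEMeasurable w μ) :
    (∫⁻ x, h x * w x ∂μ) ^ p ≤ (∫⁻ x, w x ∂μ) ^ (p - 1) * ∫⁻ x, h x ^ p * w x ∂μ := by
  have hpq := Real.HolderConjugate.conjExponent hp
  set q := p.conjExponent
  have hp0 := hpq.pos
  have hq0 := hpq.symm.pos
  have key := ENNReal.lintegral_mul_le_Lp_mul_Lq μ hpq (f := fun x => h x * w x ^ (1 / p))
    (g := fun x => w x ^ (1 / q)) (by fun_prop) (by fun_prop)
  have e₀ : ∀ x, ((fun x => h x * w x ^ (1 / p)) * fun x => w x ^ (1 / q)) x = h x * w x := by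
    intro x
    simp only [Pi.mul_apply]
    rw [mul_assoc, ← ENNReal.rpow_add_of_nonneg _ _ (by positivity) (by positivity), one_div,
      one_div, hpq.inv_add_inv_eq_one, ENNReal.rpow_one]
  have e₁ : ∀ x, (h x * w x ^ (1 / p)) ^ p = h x ^ p * w x := fun x => by
    rw [ENNReal.mul_rpow_of_nonneg _ _ hp0.le, ← ENNReal.rpow_mul, one_div_mul_cancel hp0.ne',
      ENNReal.rpow_one]
  have e₂ : ∀ x, (w x ^ (1 / q)) ^ q = w x := fun x => by
    rw [← ENNReal.rpow_mul, one_div_mul_cancel hq0.ne', ENNReal.rpow_one]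
  simp only [e₀, e₁, e₂] at key
  refine (ENNReal.rpow_le_rpow key hp0.le).trans (le_of_eq ?_)
  rw [ENNReal.mul_rpow_of_nonneg _ _ hp0.le, ← ENNReal.rpow_mul, ← ENNReal.rpow_mul,
    one_div_mul_cancel hp0.ne', ENNReal.rpow_one, mul_comm]
  congr 2
  have := hpq.sub_one_mul_conj
  field_simp
  linarith

theorem lintegral_enorm_dilate (ψ : 𝓢(V, ℂ)) (u : ℝ) (y : V) :
    ∫⁻ x, ‖dilate ψ u (x - y)‖ₑ = ∫⁻ z, ‖ψ z‖ₑ := by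
  rw [lintegral_sub_right_eq_self (fun z => ‖dilate ψ u z‖ₑ),
    ← ofReal_integral_norm_eq_lintegral_enorm (integrable_dilate ψ.integrable u),
    integral_norm_dilate, ofReal_integral_norm_eq_lintegral_enorm ψ.integrable]

/-- As `ψ` has mean zero, its averages of `f` only see the oscillation of `f` around any
constant `c`. -/
theorem enorm_dilateAvg_rpow_le {ψ : 𝓢(V, ℂ)} (hψ : ∫ z, ψ z = 0) {p : ℝ} (hp : 1 < p)
    {f : V → ℂ} (hf : Measurable f) {u : ℝ} {y : V}
    (hi : Integrable (fun x => f x * dilate ψ u (x - y))) (c : ℂ) :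
    ‖dilateAvg ψ f u y‖ₑ ^ p ≤ (∫⁻ z, ‖ψ z‖ₑ) ^ (p - 1) *
      ∫⁻ x, ‖f x - c‖ₑ ^ p * ‖dilate ψ u (x - y)‖ₑ := by
  have hd : Integrable (fun x => dilate ψ u (x - y)) :=
    (integrable_dilate ψ.integrable u).comp_sub_right y
  have h0 : ∫ x, dilate ψ u (x - y) = 0 := by
    rw [integral_sub_right_eq_self (dilate ψ u), ← hψ, ← integral_dilate (fun z => ψ z) u]
    rfl
  have h1 : dilateAvg ψ f u y = ∫ x, (f x - c) * dilate ψ u (x - y) := by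
    simp only [sub_mul]
    rw [integral_sub hi (hd.const_mul c), integral_const_mul, h0, mul_zero, sub_zero, dilateAvg]
  have hc : Measurable fun x => dilate ψ u (x - y) :=
    ((continuous_dilate_right ψ.continuous u).comp (continuous_id.sub continuous_const)).measurable
  calc ‖dilateAvg ψ f u y‖ₑ ^ p ≤ (∫⁻ x, ‖f x - c‖ₑ * ‖dilate ψ u (x - y)‖ₑ) ^ p := by
        rw [h1]
        gcongr
        simpa only [enorm_mul] using
          enorm_integral_le_lintegral_enorm (fun x => (f x - c) * dilate ψ u (x - y))
    _ ≤ _ := lintegral_mul_rpow_le hp (by fun_prop) hc.enorm.aemeasurable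
    _ = _ := by rw [lintegral_enorm_dilate]

theorem ofReal_norm_rpow_neg {z : V} (hz : z ≠ 0) (b : ℝ) :
    ENNReal.ofReal (‖z‖ ^ (-b)) = (‖z‖ₑ ^ b)⁻¹ := by
  rw [← ENNReal.ofReal_rpow_of_pos (norm_pos_iff.2 hz), ofReal_norm, ENNReal.rpow_neg]

theorem norm_dilate_le {ψ : 𝓢(V, ℂ)} {C : ℝ} {N : ℕ} (h : ∀ z, ‖ψ z‖ * (1 + ‖z‖) ^ N ≤ C)
    (u : ℝ) (z : V) :
    ‖dilate ψ u z‖ ≤ C * (exp (-(finrank ℝ V * u)) * ((1 + exp (-u) * ‖z‖) ^ N)⁻¹) := by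
  have h1 : ‖ψ (exp (-u) • z)‖ ≤ C * ((1 + exp (-u) * ‖z‖) ^ N)⁻¹ := by
    rw [← div_eq_mul_inv, le_div_iff₀ (by positivity)]
    have := h (exp (-u) • z)
    rwa [norm_smul, norm_of_nonneg (exp_pos _).le] at this
  rw [norm_dilate, mul_left_comm]
  gcongr

theorem measurable_gagliardo_integrand {f : V → ℂ} (hf : Measurable f) (p b : ℝ) :
    Measurable (fun q : V × V => ‖f q.1 - f q.2‖ₑ ^ p / ‖q.1 - q.2‖ₑ ^ b) := by
  have h1 : Measurable fun q : V × V => f q.1 := hf.comp measurable_fst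
  have h2 : Measurable fun q : V × V => f q.2 := hf.comp measurable_snd
  have h3 : Measurable fun q : V × V => q.1 - q.2 := by fun_prop
  fun_prop

theorem measurable_gagliardoDensity {f : V → ℂ} (hf : Measurable f) (s p : ℝ) :
    Measurable (gagliardoDensity s p f) :=
  (measurable_gagliardo_integrand hf p _).lintegral_prod_left'

/-- Integrating the `p`-th powers of the averages over all scales recovers the singular kernel
`|x - y|^{-d-sp}`. -/
theorem exists_lintegral_enorm_dilateAvg_rpow_le {ψ : 𝓢(V, ℂ)} (hψ : ∫ z, ψ z = 0) {s p : ℝ}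
    (hs : 0 < s) (hp : 1 < p) : ∃ C : ℝ≥0, ∀ f : V → ℂ, Measurable f →
      (∀ u y, Integrable (fun x => f x * dilate ψ u (x - y))) → ∀ y,
      ∫⁻ u, ENNReal.ofReal (exp (-(s * p) * u)) * ‖dilateAvg ψ f u y‖ₑ ^ p ≤
        C * gagliardoDensity s p f y := by
  have hp0 : 0 < p := by linarith
  have hsp : 0 < s * p := by positivity
  set b : ℝ := (finrank ℝ V : ℝ) + s * p with hb
  have hb0 : 0 < b := by positivity
  obtain ⟨N, hN⟩ := exists_nat_gt b
  obtain ⟨C₁, hC₁, h₁⟩ := exists_norm_le_schwartz ψ N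
  obtain ⟨C₂, h₂⟩ := exists_lintegral_exp_mul_min_le hb0 hN
  have hM : (∫⁻ z, ‖ψ z‖ₑ) ^ (p - 1) ≠ ∞ :=
    ENNReal.rpow_ne_top_of_nonneg (by linarith) ψ.integrable.2.ne
  set M := (∫⁻ z, ‖ψ z‖ₑ) ^ (p - 1)
  refine ⟨M.toNNReal * (C₁.toNNReal * C₂), fun f hf hi y => ?_⟩
  have hcont := continuous_dilate (V := V) ψ.continuous
  -- Scale invariance: integrating the kernel over all scales yields a power of `|z|`.
  have hkernel : ∀ z : V, z ≠ 0 →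
      ∫⁻ u, ENNReal.ofReal (exp (-(s * p) * u)) * ‖dilate ψ u z‖ₑ ≤
        (C₁.toNNReal * C₂ : ℝ≥0) * (‖z‖ₑ ^ b)⁻¹ := fun z hz => by
    have hz' : 0 < ‖z‖ := norm_pos_iff.2 hz
    rw [← ofReal_norm_rpow_neg hz, ENNReal.coe_mul, mul_assoc]
    refine le_trans ?_ (mul_le_mul_right (h₂ _ hz') _)
    rw [← lintegral_const_mul _ (by fun_prop)]
    refine lintegral_mono fun u => ?_
    rw [← ENNReal.ofReal, ← ENNReal.ofReal_mul hC₁.le, ← ofReal_norm,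
      ← ENNReal.ofReal_mul (exp_pos _).le]
    refine ENNReal.ofReal_le_ofReal ?_
    calc _ ≤ exp (-(s * p) * u) * (C₁ * (exp (-(finrank ℝ V * u)) *
          min 1 ((‖z‖ * exp (-u)) ^ (-(N : ℝ))))) := by
          gcongr
          refine (norm_dilate_le h₁ u z).trans ?_
          gcongr
          exact inv_one_add_pow_le_min (by positivity) (by positivity) (by linarith) rfl
      _ = _ := by
          rw [show -b * u = -(s * p) * u + -(finrank ℝ V * u) by rw [hb]; ring, exp_add]; ring
  have hmeas : Measurable (fun q : ℝ × V => ENNReal.ofReal (exp (-(s * p) * q.1)) *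
      (‖f q.2 - f y‖ₑ ^ p * ‖dilate ψ q.1 (q.2 - y)‖ₑ)) := by
    have h1 : Measurable fun q : ℝ × V => f q.2 := hf.comp measurable_snd
    have h2 : Measurable fun q : ℝ × V => dilate ψ q.1 (q.2 - y) :=
      (hcont.comp (continuous_fst.prodMk (continuous_snd.sub continuous_const))).measurable
    fun_prop
  calc _ ≤ ∫⁻ u, M * ∫⁻ x, ENNReal.ofReal (exp (-(s * p) * u)) *
        (‖f x - f y‖ₑ ^ p * ‖dilate ψ u (x - y)‖ₑ) := by
        refine lintegral_mono fun u => ?_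
        simp only []
        rw [lintegral_const_mul' _ _ ENNReal.ofReal_ne_top, mul_left_comm]
        gcongr
        exact enorm_dilateAvg_rpow_le hψ hp hf (hi u y) (f y)
    _ = M * ∫⁻ x, ∫⁻ u, ENNReal.ofReal (exp (-(s * p) * u)) *
        (‖f x - f y‖ₑ ^ p * ‖dilate ψ u (x - y)‖ₑ) := by
        rw [lintegral_const_mul' _ _ hM, lintegral_lintegral_swap hmeas.aemeasurable]
    _ ≤ M * ∫⁻ x, (C₁.toNNReal * C₂ : ℝ≥0) * (‖f x - f y‖ₑ ^ p / ‖x - y‖ₑ ^ b) := by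
        gcongr with x
        -- On the diagonal both sides vanish, since `0 / 0 = 0` in `ℝ≥0∞`.
        rcases eq_or_ne x y with rfl | hxy
        · simp [hp0]
        · rw [div_eq_mul_inv, mul_left_comm]
          refine le_trans (le_of_eq ?_) (mul_le_mul_right (hkernel _ (sub_ne_zero.2 hxy)) _)
          rw [← lintegral_const_mul' _ _
            (ENNReal.rpow_ne_top_of_nonneg hp0.le enorm_ne_top)]
          exact lintegral_congr fun u => mul_left_comm _ _ _
    _ = _ := by
        rw [lintegral_const_mul' _ _ ENNReal.coe_ne_top, ← mul_assoc, gagliardoDensity,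
          ENNReal.coe_mul M.toNNReal, ENNReal.coe_toNNReal hM]

/-- The pointwise bound on averages at a fixed scale: the constant `c` is replaced by the values
`f z`, averaged over `z` in the ball of radius the scale. -/
theorem exists_enorm_dilateAvg_rpow_le {ψ : 𝓢(V, ℂ)} (hψ : ∫ z, ψ z = 0) {s p : ℝ}
    (hs : 0 < s) (hp : 1 < p) : ∃ C : ℝ≥0, ∀ f : V → ℂ, Measurable f →
      (∀ u y, Integrable (fun x => f x * dilate ψ u (x - y))) → ∀ u y,
      ‖dilateAvg ψ f u y‖ₑ ^ p ≤ C * (∫⁻ z, gagliardoDensity s p f z) *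
        ENNReal.ofReal (exp ((s * p - finrank ℝ V) * u)) := by
  have hp0 : 0 < p := by linarith
  have hsp : 0 < s * p := by positivity
  set b : ℝ := (finrank ℝ V : ℝ) + s * p with hb
  have hb0 : 0 < b := by positivity
  obtain ⟨N, hN⟩ := exists_nat_gt b
  obtain ⟨C₁, hC₁, h₁⟩ := exists_norm_le_schwartz ψ N
  have hM : (∫⁻ z, ‖ψ z‖ₑ) ^ (p - 1) ≠ ∞ :=
    ENNReal.rpow_ne_top_of_nonneg (by linarith) ψ.integrable.2.ne
  set M := (∫⁻ z, ‖ψ z‖ₑ) ^ (p - 1)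
  set ω := volume (Metric.ball (0 : V) 1) with hω
  have hω0 : ω ≠ 0 := (Metric.measure_ball_pos volume 0 one_pos).ne'
  have hω1 : ω ≠ ∞ := measure_ball_lt_top.ne
  refine ⟨ω.toNNReal⁻¹ * M.toNNReal * C₁.toNNReal, fun f hf hi u y => ?_⟩
  -- For `z` within one scale of `y`, decay in `x - y` is decay in `x - z`.
  have hkernel : ∀ z ∈ Metric.ball y (exp u), ∀ x, x ≠ z → ‖dilate ψ u (x - y)‖ₑ ≤
      C₁.toNNReal * ENNReal.ofReal (exp (s * p * u)) * (‖x - z‖ₑ ^ b)⁻¹ := fun z hz x hxz => by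
    have hz' : 0 < ‖x - z‖ := norm_pos_iff.2 (sub_ne_zero.2 hxz)
    rw [← ofReal_norm_rpow_neg (sub_ne_zero.2 hxz), ← ENNReal.ofReal, ← ENNReal.ofReal_mul hC₁.le,
      ← ENNReal.ofReal_mul (by positivity), ← ofReal_norm]
    refine ENNReal.ofReal_le_ofReal ((norm_dilate_le h₁ u _).trans ?_)
    have hle : exp (-u) * ‖x - z‖ ≤ 1 + exp (-u) * ‖x - y‖ := by
      have h1 : ‖x - z‖ ≤ exp u + ‖x - y‖ := by
        rw [Metric.mem_ball, dist_eq_norm] at hz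
        have := norm_sub_le (x - y) (z - y)
        rw [sub_sub_sub_cancel_right] at this
        linarith
      calc _ ≤ exp (-u) * (exp u + ‖x - y‖) := by gcongr
        _ = _ := by rw [mul_add, ← exp_add]; simp
    have h2 : ((1 + exp (-u) * ‖x - y‖) ^ N)⁻¹ ≤ (exp (-u) * ‖x - z‖) ^ (-b) := by
      have h3 : (0 : ℝ) ≤ exp (-u) * ‖x - y‖ := by positivity
      calc _ ≤ (1 + exp (-u) * ‖x - y‖) ^ (-b) := by
            rw [← rpow_natCast, ← rpow_neg (by linarith)]
            exact rpow_le_rpow_of_exponent_le (by linarith) (by linarith)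
        _ ≤ _ := rpow_le_rpow_of_nonpos (by positivity) hle (by linarith)
    calc _ ≤ C₁ * (exp (-(finrank ℝ V * u)) * (exp (-u) * ‖x - z‖) ^ (-b)) := by gcongr
      _ = C₁ * (exp (-(finrank ℝ V * u)) * exp (b * u)) * ‖x - z‖ ^ (-b) := by
        rw [mul_rpow (exp_pos _).le (norm_nonneg _), ← exp_mul]
        ring_nf
      _ = _ := by
        rw [← exp_add, hb]
        ring_nf
  have hball : volume (Metric.ball y (exp u)) = ENNReal.ofReal (exp (finrank ℝ V * u)) * ω := by
    rw [Measure.addHaar_ball_of_pos _ _ (exp_pos _), ← exp_nat_mul]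
  have key : ‖dilateAvg ψ f u y‖ₑ ^ p * (ENNReal.ofReal (exp (finrank ℝ V * u)) * ω) ≤
      M * (C₁.toNNReal * ENNReal.ofReal (exp (s * p * u)) * ∫⁻ z, gagliardoDensity s p f z) := by
    rw [← hball, ← setLIntegral_const, ← lintegral_const_mul' _ _ (by finiteness),
      ← lintegral_const_mul' _ _ hM]
    refine le_trans (setLIntegral_mono' measurableSet_ball fun z hz => ?_)
      (setLIntegral_le_lintegral (Metric.ball y (exp u)) _)
    refine (enorm_dilateAvg_rpow_le hψ hp hf (hi u y) (f z)).trans ?_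
    gcongr
    rw [gagliardoDensity, ← lintegral_const_mul' _ _ (by finiteness)]
    refine lintegral_mono fun x => ?_
    rcases eq_or_ne x z with rfl | hxz
    · simp [hp0]
    · rw [div_eq_mul_inv, mul_left_comm]
      gcongr
      exact hkernel z hz x hxz
  have hmul := mul_le_mul_left key (ENNReal.ofReal (exp (-(finrank ℝ V * u))) * ω⁻¹)
  calc _ = ‖dilateAvg ψ f u y‖ₑ ^ p * (ENNReal.ofReal (exp (finrank ℝ V * u)) * ω) *
        (ENNReal.ofReal (exp (-(finrank ℝ V * u))) * ω⁻¹) := by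
        rw [mul_assoc, mul_mul_mul_comm, ← ENNReal.ofReal_mul (exp_pos _).le, ← exp_add,
          ENNReal.mul_inv_cancel hω0 hω1]
        simp
    _ ≤ _ := hmul
    _ = _ := by
        rw [show (s * p - finrank ℝ V) * u = s * p * u + -(finrank ℝ V * u) by ring, exp_add,
          ENNReal.ofReal_mul (exp_pos _).le]
        rw [ENNReal.coe_mul, ENNReal.coe_mul, ENNReal.coe_toNNReal hM, ENNReal.coe_inv,
          ENNReal.coe_toNNReal hω1]
        · ring
        · exact (ENNReal.toNNReal_ne_zero.2 ⟨hω0, hω1⟩)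

end Averages

/-! ### Duality and superposition over scales -/

section Pairing

variable {V : Type*} [NormedAddCommGroup V] [InnerProductSpace ℝ V] [FiniteDimensional ℝ V]
  [MeasurableSpace V] [BorelSpace V]

/-- At a fixed scale the kernel separates: polynomial growth in `y` buys decay in `x`. -/
theorem exists_norm_dilate_sub_le (ψ : 𝓢(V, ℂ)) (u : ℝ) (N : ℕ) :
    ∃ C, 0 ≤ C ∧ ∀ x y, ‖dilate ψ u (x - y)‖ ≤ C * (((1 + ‖x‖) ^ N)⁻¹ * (1 + ‖y‖) ^ N) := by
  obtain ⟨C₁, hC₁, h₁⟩ := exists_norm_le_schwartz ψ N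
  refine ⟨C₁ * exp (-(finrank ℝ V * u)) * (exp |u|) ^ N, by positivity, fun x y => ?_⟩
  refine (norm_dilate_le h₁ u _).trans ?_
  have h2 : 1 + ‖x‖ ≤ exp |u| * (1 + exp (-u) * ‖x - y‖) * (1 + ‖y‖) := by
    have h := one_add_mul_norm_le zero_le_one x y
    simp only [one_mul] at h
    refine h.trans ?_
    gcongr
    have h3 : 1 ≤ exp |u| := one_le_exp (abs_nonneg u)
    have h4 : 1 ≤ exp |u| * exp (-u) := by
      rw [← exp_add]; exact one_le_exp (by linarith [le_abs_self u])
    rw [mul_add, mul_one, ← mul_assoc]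
    gcongr
    exact le_mul_of_one_le_left (norm_nonneg _) h4
  have h3 : ((1 + exp (-u) * ‖x - y‖) ^ N)⁻¹ ≤
      (exp |u|) ^ N * (((1 + ‖x‖) ^ N)⁻¹ * (1 + ‖y‖) ^ N) := by
    rw [mul_left_comm, ← div_eq_inv_mul, inv_le_iff_one_le_mul₀ (by positivity),
      div_mul_eq_mul_div, one_le_div (by positivity), ← mul_pow, ← mul_pow]
    gcongr
    linarith
  calc _ ≤ C₁ * (exp (-(finrank ℝ V * u)) *
        ((exp |u|) ^ N * (((1 + ‖x‖) ^ N)⁻¹ * (1 + ‖y‖) ^ N))) := by gcongr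
    _ = _ := by ring

theorem integrable_norm_mul_inv_one_add_pow {a : ℝ} {f : V → ℂ} (hf : Measurable f)
    (hfw : Integrable (fun x => (((1 + ‖x‖) ^ (-a) : ℝ) : ℂ) * f x)) {N : ℕ} (hN : a ≤ N) :
    Integrable (fun x => ‖f x‖ * ((1 + ‖x‖) ^ N)⁻¹) := by
  refine hfw.mono (by fun_prop) (Filter.Eventually.of_forall fun x => ?_)
  have hx : (1 : ℝ) ≤ 1 + ‖x‖ := by linarith [norm_nonneg x]
  rw [norm_mul, norm_mul, norm_norm, Complex.norm_real, mul_comm, norm_of_nonneg (by positivity),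
    norm_of_nonneg (by positivity), ← rpow_natCast, ← rpow_neg (by positivity)]
  gcongr

theorem integrable_mul_dilate {a : ℝ} {f : V → ℂ} (hf : Measurable f)
    (hfw : Integrable (fun x => (((1 + ‖x‖) ^ (-a) : ℝ) : ℂ) * f x)) (ψ : 𝓢(V, ℂ)) (u : ℝ)
    (y : V) : Integrable (fun x => f x * dilate ψ u (x - y)) := by
  obtain ⟨N, hN⟩ := exists_nat_ge a
  obtain ⟨C, hC, h⟩ := exists_norm_dilate_sub_le ψ u N
  have hm : Measurable fun x => dilate ψ u (x - y) :=
    ((continuous_dilate_right ψ.continuous u).comp (continuous_id.sub continuous_const)).measurable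
  refine ((integrable_norm_mul_inv_one_add_pow hf hfw hN).mul_const (C * (1 + ‖y‖) ^ N)).mono'
    (hf.mul hm).aestronglyMeasurable (Filter.Eventually.of_forall fun x => ?_)
  rw [norm_mul]
  calc _ ≤ ‖f x‖ * (C * (((1 + ‖x‖) ^ N)⁻¹ * (1 + ‖y‖) ^ N)) := by gcongr; exact h x y
    _ = _ := by ring

/-- At each scale, averaging a Schwartz function is dual to averaging `f`. -/
theorem integral_mul_integral_dilate {a : ℝ} {f : V → ℂ} (hf : Measurable f)
    (hfw : Integrable (fun x => (((1 + ‖x‖) ^ (-a) : ℝ) : ℂ) * f x)) (ψ φ : 𝓢(V, ℂ)) (u : ℝ) :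
    ∫ x, f x * ∫ y, dilate ψ u (x - y) * φ y = ∫ y, dilateAvg ψ f u y * φ y := by
  obtain ⟨N, hN⟩ := exists_nat_ge a
  obtain ⟨C, hC, h⟩ := exists_norm_dilate_sub_le ψ u N
  have hm : Measurable fun q : V × V => dilate ψ u (q.1 - q.2) :=
    ((continuous_dilate_right ψ.continuous u).comp (continuous_fst.sub continuous_snd)).measurable
  have hi : Integrable (fun q : V × V => f q.1 * (dilate ψ u (q.1 - q.2) * φ q.2))
      (volume.prod volume) := by
    refine (((integrable_norm_mul_inv_one_add_pow hf hfw hN).mul_prod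
      (integrable_norm_mul_one_add_norm_pow φ N)).const_mul C).mono'
      ((hf.comp measurable_fst).mul
        (hm.mul (φ.continuous.measurable.comp measurable_snd))).aestronglyMeasurable
      (Filter.Eventually.of_forall fun q => ?_)
    rw [norm_mul, norm_mul]
    calc _ ≤ ‖f q.1‖ * (C * (((1 + ‖q.1‖) ^ N)⁻¹ * (1 + ‖q.2‖) ^ N) * ‖φ q.2‖) := by
          gcongr; exact h _ _
      _ = _ := by ring
  simp only [← integral_const_mul]
  rw [integral_integral_swap hi]
  refine integral_congr_ae (Filter.Eventually.of_forall fun y => ?_)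
  simp only [dilateAvg, ← mul_assoc]
  rw [integral_mul_const]

theorem stronglyMeasurable_dilateAvg {f : V → ℂ} (hf : Measurable f) (ψ : 𝓢(V, ℂ)) :
    StronglyMeasurable (fun q : ℝ × V => dilateAvg ψ f q.1 q.2) := by
  have hc : Continuous fun r : (ℝ × V) × V => dilate ψ r.1.1 (r.2 - r.1.2) :=
    (continuous_dilate ψ.continuous).comp (by fun_prop : Continuous fun r : (ℝ × V) × V =>
      (r.1.1, r.2 - r.1.2))
  exact StronglyMeasurable.integral_prod_right (f := fun (q : ℝ × V) (x : V) =>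
    f x * dilate ψ q.1 (x - q.2))
    ((hf.comp measurable_snd).mul hc.measurable).stronglyMeasurable

theorem stronglyMeasurable_integral_dilate (ψ φ : 𝓢(V, ℂ)) :
    StronglyMeasurable (fun q : ℝ × V => ∫ y, dilate ψ q.1 (q.2 - y) * φ y) := by
  have hc : Continuous fun r : (ℝ × V) × V => dilate ψ r.1.1 (r.1.2 - r.2) * φ r.2 :=
    ((continuous_dilate ψ.continuous).comp (by fun_prop : Continuous fun r : (ℝ × V) × V =>
      (r.1.1, r.1.2 - r.2))).mul (φ.continuous.comp continuous_snd)
  exact StronglyMeasurable.integral_prod_right (f := fun (q : ℝ × V) (y : V) =>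
    dilate ψ q.1 (q.2 - y) * φ y) hc.stronglyMeasurable

/-- Duality at each scale passes to superpositions over all scales, provided the two double
integrals converge absolutely. -/
theorem integral_mul_integral_swap {w : ℝ → ℂ} (hw : Measurable w) {f φ : V → ℂ}
    (hf : Measurable f) (hφ : Measurable φ) {K A : ℝ → V → ℂ}
    (hK : Measurable (Function.uncurry K)) (hA : Measurable (Function.uncurry A))
    (hdual : ∀ u, ∫ x, f x * K u x = ∫ y, A u y * φ y)
    (hfK : ∫⁻ x, ‖f x‖ₑ * ∫⁻ u, ‖w u * K u x‖ₑ ≠ ∞)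
    (hAφ : ∫⁻ y, (∫⁻ u, ‖w u * A u y‖ₑ) * ‖φ y‖ₑ ≠ ∞) :
    Integrable (fun x => f x * ∫ u, w u * K u x) ∧
      Integrable (fun y => (∫ u, w u * A u y) * φ y) ∧
      ∫ x, f x * ∫ u, w u * K u x = ∫ y, (∫ u, w u * A u y) * φ y := by
  have h1 : Integrable (fun q : V × ℝ => f q.1 * (w q.2 * K q.2 q.1)) (volume.prod volume) := by
    have hm : Measurable (fun q : V × ℝ => f q.1 * (w q.2 * K q.2 q.1)) :=
      (hf.comp measurable_fst).mul ((hw.comp measurable_snd).mul (hK.comp measurable_swap))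
    refine ⟨hm.aestronglyMeasurable, ?_⟩
    rw [HasFiniteIntegral, lintegral_prod _ hm.enorm.aemeasurable, lt_top_iff_ne_top]
    simpa only [enorm_mul (f _), lintegral_const_mul' _ _ enorm_ne_top] using hfK
  have h2 : Integrable (fun q : ℝ × V => w q.1 * A q.1 q.2 * φ q.2) (volume.prod volume) := by
    have hm : Measurable (fun q : ℝ × V => w q.1 * A q.1 q.2 * φ q.2) :=
      ((hw.comp measurable_fst).mul hA).mul (hφ.comp measurable_snd)
    refine ⟨hm.aestronglyMeasurable, ?_⟩
    rw [HasFiniteIntegral, lintegral_prod_symm _ hm.enorm.aemeasurable, lt_top_iff_ne_top]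
    simpa only [enorm_mul _ (φ _), lintegral_mul_const' _ _ enorm_ne_top] using hAφ
  have e1 : (fun x => f x * ∫ u, w u * K u x) = fun x => ∫ u, f x * (w u * K u x) := by
    simp only [integral_const_mul]
  have e2 : (fun y => (∫ u, w u * A u y) * φ y) = fun y => ∫ u, w u * A u y * φ y := by
    simp only [integral_mul_const]
  rw [e1, e2]
  refine ⟨h1.integral_prod_left, h2.integral_prod_right, ?_⟩
  rw [integral_integral_swap h1, ← integral_integral_swap (f := fun u y => w u * A u y * φ y) h2]
  refine integral_congr_ae (Filter.Eventually.of_forall fun u => ?_)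
  simp only [mul_left_comm (f _), mul_assoc (w _), integral_const_mul]
  rw [hdual]

theorem enorm_exp_mul (x : ℝ) (z : ℂ) :
    ‖((exp x : ℝ) : ℂ) * z‖ₑ = ENNReal.ofReal (exp x) * ‖z‖ₑ := by
  rw [enorm_mul, ← ofReal_norm (E := ℂ) ((exp x : ℝ) : ℂ), Complex.norm_real,
    norm_of_nonneg (exp_pos _).le]

/-- The superposition over all scales can be moved from the Schwartz function to `f`. -/
theorem integral_mul_integral_scales {a t : ℝ} {f : V → ℂ} (hf : Measurable f)
    (hfw : Integrable (fun x => (((1 + ‖x‖) ^ (-a) : ℝ) : ℂ) * f x)) (ψ φ : 𝓢(V, ℂ))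
    {C : ℝ≥0} (hC : ∀ x, ∫⁻ u : ℝ, ‖((exp (-t * u) : ℝ) : ℂ) *
      ∫ y, dilate ψ u (x - y) * φ y‖ₑ ≤ C * ENNReal.ofReal ((1 + ‖x‖) ^ (-a)))
    (hT : ∫⁻ y, (∫⁻ u, ENNReal.ofReal (exp (-t * u)) * ‖dilateAvg ψ f u y‖ₑ) * ‖φ y‖ₑ ≠ ∞) :
    Integrable (fun x => f x * ∫ u : ℝ, ((exp (-t * u) : ℝ) : ℂ) *
        ∫ y, dilate ψ u (x - y) * φ y) ∧
      Integrable (fun y => (∫ u : ℝ, ((exp (-t * u) : ℝ) : ℂ) * dilateAvg ψ f u y) * φ y) ∧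
      ∫ x, f x * ∫ u : ℝ, ((exp (-t * u) : ℝ) : ℂ) * ∫ y, dilate ψ u (x - y) * φ y =
        ∫ y, (∫ u : ℝ, ((exp (-t * u) : ℝ) : ℂ) * dilateAvg ψ f u y) * φ y := by
  refine integral_mul_integral_swap (w := fun u => ((exp (-t * u) : ℝ) : ℂ))
    (K := fun u x => ∫ y, dilate ψ u (x - y) * φ y) (A := fun u y => dilateAvg ψ f u y)
    (Continuous.measurable (by fun_prop)) hf φ.continuous.measurable
    (stronglyMeasurable_integral_dilate ψ φ).measurable
    (stronglyMeasurable_dilateAvg hf ψ).measurable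
    (integral_mul_integral_dilate hf hfw ψ φ) ?_ ?_
  · refine (lt_of_le_of_lt (lintegral_mono (g := fun x => C *
      ‖(((1 + ‖x‖) ^ (-a) : ℝ) : ℂ) * f x‖ₑ) fun x => ?_) ?_).ne
    · refine (mul_le_mul_right (hC x) _).trans (le_of_eq ?_)
      beta_reduce
      rw [enorm_mul, ← ofReal_norm (E := ℂ) (((1 + ‖x‖) ^ (-a) : ℝ) : ℂ), Complex.norm_real,
        norm_of_nonneg (by positivity)]
      ring
    · rw [lintegral_const_mul' _ _ ENNReal.coe_ne_top]
      exact ENNReal.mul_lt_top ENNReal.coe_lt_top hfw.2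
  · simpa only [enorm_exp_mul] using hT

/-- The `L^{p*}` bound for the square function of `f` by its Gagliardo seminorm. -/
theorem exists_lintegral_scales_rpow_le {ψ : 𝓢(V, ℂ)} (hψ : ∫ z, ψ z = 0) {s t p : ℝ}
    (ht : 0 ≤ t) (hst : t < s) (hp : 1 < p) (hpd : (s - t) * p < finrank ℝ V) :
    ∃ C : ℝ≥0, ∀ f : V → ℂ, Measurable f →
      (∀ u y, Integrable (fun x => f x * dilate ψ u (x - y))) →
      ∫⁻ y, (∫⁻ u, ENNReal.ofReal (exp (-t * u)) * ‖dilateAvg ψ f u y‖ₑ) ^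
          ((finrank ℝ V : ℝ) * p / (finrank ℝ V - (s - t) * p)) ≤
        C * (∫⁻ y, gagliardoDensity s p f y) ^
          ((finrank ℝ V : ℝ) / (finrank ℝ V - (s - t) * p)) := by
  have hD : 0 < finrank ℝ V - (s - t) * p := by linarith
  have hr' : 0 < (s - t) * p / (finrank ℝ V - (s - t) * p) :=
    div_pos (mul_pos (by linarith) (by linarith)) hD
  obtain ⟨C₁, h₁⟩ := exists_lintegral_enorm_dilateAvg_rpow_le hψ (by linarith : 0 < s) hp
  obtain ⟨C₂, h₂⟩ := exists_enorm_dilateAvg_rpow_le hψ (by linarith : 0 < s) hp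
  obtain ⟨C₃, h₃⟩ := exists_lintegral_exp_mul_rpow_le hst hp hpd
  set e := (s - t) * p / (finrank ℝ V - (s - t) * p) with he
  refine ⟨C₃ * C₁ * (C₂ ^ e), fun f hf hi => ?_⟩
  set I := ∫⁻ y, gagliardoDensity s p f y with hI
  have hA := stronglyMeasurable_dilateAvg hf ψ
  calc _ ≤ ∫⁻ y, C₃ * ((C₁ * gagliardoDensity s p f y) * (C₂ * I) ^ e) := by
        refine lintegral_mono fun y => h₃ _ _ _ ?_ (h₁ f hf hi y) fun u => h₂ f hf hi u y
        exact (hA.measurable.comp measurable_prodMk_right).enorm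
    _ = (C₃ * C₁ * (C₂ ^ e) : ℝ≥0) * (I * I ^ e) := by
        simp only [ENNReal.mul_rpow_of_nonneg _ _ hr'.le, ENNReal.coe_mul,
          ENNReal.coe_rpow_of_nonneg _ hr'.le]
        rw [hI]
        simp only [← mul_assoc]
        rw [lintegral_mul_const _ (by have := measurable_gagliardoDensity hf s p; fun_prop),
          lintegral_mul_const _ (by have := measurable_gagliardoDensity hf s p; fun_prop),
          lintegral_const_mul' _ _ (by finiteness)]
        ring
    _ = _ := by
        congr 1
        nth_rw 1 [← ENNReal.rpow_one I]
        rw [← ENNReal.rpow_add_of_nonneg _ _ zero_le_one hr'.le, he]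
        congr 1
        field_simp
        ring

end Pairing

/-! ### The fractional Laplacian on Schwartz functions -/

section Symmetry

variable {n : ℕ}

theorem integrable_symbol_mul {t : ℝ} (ht : 0 ≤ t) (φ : 𝓢(EuclideanSpace ℝ (Fin n), ℂ)) :
    Integrable (fun ξ : EuclideanSpace ℝ (Fin n) =>
      (((2 * π * ‖ξ‖) ^ t : ℝ) : ℂ) * 𝓕 φ ξ) := by
  obtain ⟨N, hN⟩ := exists_nat_ge t
  have hc : Continuous fun ξ : EuclideanSpace ℝ (Fin n) => (2 * π * ‖ξ‖) ^ t :=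
    Continuous.rpow_const (by fun_prop) fun _ => Or.inr ht
  refine ((integrable_norm_mul_one_add_norm_pow (𝓕 φ) N).const_mul ((2 * π) ^ t)).mono'
    ((Complex.continuous_ofReal.comp hc).mul (𝓕 φ).continuous).aestronglyMeasurable
    (Filter.Eventually.of_forall fun ξ => ?_)
  rw [norm_mul, Complex.norm_real, norm_of_nonneg (by positivity),
    mul_rpow (by positivity) (norm_nonneg _), mul_assoc, mul_comm (‖ξ‖ ^ t)]
  have h2 : ‖ξ‖ ^ t ≤ (1 + ‖ξ‖) ^ N := by
    rw [← rpow_natCast]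
    calc ‖ξ‖ ^ t ≤ (1 + ‖ξ‖) ^ t := by gcongr; linarith
      _ ≤ _ := rpow_le_rpow_of_exponent_le (by linarith [norm_nonneg ξ]) hN
  gcongr

theorem continuous_fracLaplacian {t : ℝ} (ht : 0 ≤ t) (φ : 𝓢(EuclideanSpace ℝ (Fin n), ℂ)) :
    Continuous (fracLaplacian t φ) := by
  unfold fracLaplacian
  rw [Real.fourierInv_eq_fourier_comp_neg]
  exact VectorFourier.fourierIntegral_continuous Real.continuous_fourierChar continuous_inner
    (integrable_symbol_mul ht φ).comp_neg

/-- Moves the Fourier transform onto `f`; the right-hand side is symmetric in `f` and `φ` up to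
`ξ ↦ -ξ`. -/
theorem integral_mul_fracLaplacian {t : ℝ} (ht : 0 ≤ t)
    (f φ : 𝓢(EuclideanSpace ℝ (Fin n), ℂ)) :
    ∫ x, f x * fracLaplacian t φ x =
      ∫ ξ : EuclideanSpace ℝ (Fin n), (((2 * π * ‖ξ‖) ^ t : ℝ) : ℂ) * (𝓕 φ (-ξ) * 𝓕 f ξ) := by
  have h := VectorFourier.integral_fourierIntegral_smul_eq_flip
    (L := innerₗ (EuclideanSpace ℝ (Fin n))) (μ := volume) (ν := volume)
    Real.continuous_fourierChar continuous_inner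
    (integrable_symbol_mul ht φ).comp_neg f.integrable
  simp only [smul_eq_mul, flip_innerₗ, norm_neg] at h
  calc _ = _ := ?_
    _ = _ := h
    _ = _ := ?_
  · refine integral_congr_ae (Filter.Eventually.of_forall fun x => ?_)
    simp only [fracLaplacian]
    rw [Real.fourierInv_eq_fourier_comp_neg, mul_comm]
    simp only [norm_neg]
    rfl
  · refine integral_congr_ae (Filter.Eventually.of_forall fun ξ => ?_)
    simp only [mul_assoc]
    rfl

/-- The fractional Laplacian is its own transpose, because its symbol is even. -/
theorem integral_mul_fracLaplacian_comm {t : ℝ} (ht : 0 ≤ t)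
    (f φ : 𝓢(EuclideanSpace ℝ (Fin n), ℂ)) :
    ∫ x, f x * fracLaplacian t φ x = ∫ x, fracLaplacian t f x * φ x := by
  simp only [mul_comm (fracLaplacian t f _)]
  rw [integral_mul_fracLaplacian ht, integral_mul_fracLaplacian ht,
    ← integral_neg_eq_self (μ := (volume : Measure (EuclideanSpace ℝ (Fin n))))]
  simp only [norm_neg, neg_neg, mul_comm (𝓕 φ _)]

theorem inFracDomain_schwartz {t : ℝ} (ht : 0 ≤ t) (f : 𝓢(EuclideanSpace ℝ (Fin n), ℂ)) :
    InFracDomain t f := by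
  have hc : Continuous fun x : EuclideanSpace ℝ (Fin n) => (1 + ‖x‖) ^ (-((n : ℝ) + t)) :=
    Continuous.rpow_const (by fun_prop) fun x => Or.inl (by positivity)
  refine f.integrable.bdd_mul (c := 1)
    (Complex.continuous_ofReal.comp hc).aestronglyMeasurable
    (Filter.Eventually.of_forall fun x => ?_)
  rw [Complex.norm_real, norm_of_nonneg (by positivity)]
  refine rpow_le_one_of_one_le_of_nonpos (by linarith [norm_nonneg x]) ?_
  have : (0 : ℝ) ≤ n := n.cast_nonneg
  linarith

/-- On Schwartz functions the weak fractional Laplacian agrees with the Fourier multiplier. -/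
theorem IsWeakFracLaplacian.ae_eq_fracLaplacian {t : ℝ} (ht : 0 ≤ t)
    {f : 𝓢(EuclideanSpace ℝ (Fin n), ℂ)} {g : EuclideanSpace ℝ (Fin n) → ℂ}
    (h : IsWeakFracLaplacian t f g) : fracLaplacian t f =ᵐ[volume] g := by
  have hloc : LocallyIntegrable (fracLaplacian t f) :=
    (continuous_fracLaplacian ht f).locallyIntegrable
  refine ae_eq_of_integral_contDiff_smul_eq hloc h.1 fun η hη hηc => ?_
  have hηs : HasCompactSupport fun x => ((η x : ℝ) : ℂ) := hηc.comp_left Complex.ofReal_zero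
  have key := (h.2 (hηs.toSchwartzMap (Complex.ofRealCLM.contDiff.comp hη))).2.2
  rw [integral_mul_fracLaplacian_comm ht] at key
  simpa only [HasCompactSupport.toSchwartzMap_toFun, Complex.real_smul, mul_comm] using! key

end Symmetry

/-! ### The weak fractional Laplacian of a measurable function -/

section Final

variable {n : ℕ}

theorem gagliardo_eq {s p : ℝ} (f : EuclideanSpace ℝ (Fin n) → ℂ) :
    gagliardo s p f = (∫⁻ y, gagliardoDensity s p f y) ^ (1 / p) := by
  simp only [gagliardo, gagliardoDensity, finrank_euclideanSpace_fin]

theorem gagliardo_congr {s p : ℝ} {f f' : EuclideanSpace ℝ (Fin n) → ℂ} (h : f =ᵐ[volume] f') :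
    gagliardo s p f = gagliardo s p f' := by
  unfold gagliardo
  congr 1
  refine lintegral_congr_ae (h.mono fun y hy => ?_)
  exact lintegral_congr_ae (h.mono fun x hx => by simp only [hx, hy])

theorem InFracDomain.congr {t : ℝ} {f f' : EuclideanSpace ℝ (Fin n) → ℂ} (hf : InFracDomain t f)
    (h : f =ᵐ[volume] f') : InFracDomain t f' :=
  Integrable.congr hf (h.mono fun x hx => by simp only [hx])

/-- The weight is positive and continuous, so it can be divided out. -/
theorem InFracDomain.aestronglyMeasurable {t : ℝ} {f : EuclideanSpace ℝ (Fin n) → ℂ}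
    (hf : InFracDomain t f) : AEStronglyMeasurable f := by
  have hc : Continuous fun x : EuclideanSpace ℝ (Fin n) => (1 + ‖x‖) ^ ((n : ℝ) + t) :=
    Continuous.rpow_const (by fun_prop) fun x => Or.inl (by positivity)
  refine ((Complex.continuous_ofReal.comp hc).aestronglyMeasurable.mul hf.1).congr
    (Filter.Eventually.of_forall fun x => ?_)
  have hx : 0 < 1 + ‖x‖ := by positivity
  simp only [Pi.mul_apply, Function.comp_apply]
  rw [← mul_assoc, ← Complex.ofReal_mul, ← rpow_add hx]
  simp

theorem IsWeakFracLaplacian.congr {t : ℝ} {f f' g : EuclideanSpace ℝ (Fin n) → ℂ}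
    (hf : IsWeakFracLaplacian t f g) (h : f =ᵐ[volume] f') : IsWeakFracLaplacian t f' g := by
  refine ⟨hf.1, fun φ => ?_⟩
  have h' : (fun x => f x * fracLaplacian t φ x) =ᵐ[volume] fun x => f' x * fracLaplacian t φ x :=
    h.mono fun x hx => by simp only [hx]
  obtain ⟨h1, h2, h3⟩ := hf.2 φ
  exact ⟨h1.congr h', h2, (integral_congr_ae h').symm.trans h3⟩

/-- The Calderón formula for the fractional Laplacian. For `t = 0` the symbol at the origin is
`0 ^ 0 = 1`, which the null set `{0}` makes harmless. -/
theorem fracLaplacian_eq (hn : 0 < n) (k : ℕ) {t : ℝ} (ht : 0 ≤ t)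
    (φ : 𝓢(EuclideanSpace ℝ (Fin n), ℂ)) (x : EuclideanSpace ℝ (Fin n)) :
    fracLaplacian t φ x = (((2 * π) ^ t / calderonConst k t : ℝ) : ℂ) *
      ∫ u : ℝ, ((exp (-t * u) : ℝ) : ℂ) * ∫ y, dilate
        (𝓕⁻ (mulNormSqPow k (annulus (EuclideanSpace ℝ (Fin n)))) :
          𝓢(EuclideanSpace ℝ (Fin n), ℂ)) u (x - y) * φ y := by
  have : Nonempty (Fin n) := ⟨⟨0, hn⟩⟩
  have hc : (calderonConst k t : ℂ) ≠ 0 := Complex.ofReal_ne_zero.2 (calderonConst_pos k t).ne'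
  rw [integral_exp_mul_integral_dilate k ht, ← mul_assoc, Complex.ofReal_div,
    div_mul_cancel₀ _ hc, fracLaplacian, Real.fourierInv_eq, Real.fourierInv_eq,
    ← integral_const_mul]
  refine integral_congr_ae (Filter.Eventually.of_forall fun ξ => ?_)
  simp only [mul_rpow (by positivity : 0 ≤ 2 * π) (norm_nonneg ξ), Circle.smul_def, smul_eq_mul,
    Complex.ofReal_mul]
  ring

theorem integral_fourierInv_mulNormSqPow {k : ℕ} (hk : k ≠ 0)
    (φ : 𝓢(EuclideanSpace ℝ (Fin n), ℂ)) :
    ∫ z, (𝓕⁻ (mulNormSqPow k φ) : 𝓢(EuclideanSpace ℝ (Fin n), ℂ)) z = 0 := by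
  have h : 𝓕 (𝓕⁻ (mulNormSqPow k φ) : 𝓢(EuclideanSpace ℝ (Fin n), ℂ)) 0 = 0 := by
    rw [FourierTransform.fourier_fourierInv_eq, mulNormSqPow_apply]
    simp [hk]
  rw [SchwartzMap.fourier_coe, Real.fourier_eq] at h
  simpa using h

/-- The estimate for measurable functions: the weak fractional Laplacian is the superposition of
the averages of `f` over all scales. -/
theorem exists_isWeakFracLaplacian_of_measurable (hn : 0 < n) {s t p : ℝ} (ht : 0 ≤ t)
    (hst : t < s) (hp : 1 < p) (hpn : (s - t) * p < n) :
    ∃ C : ℝ≥0, ∀ f : EuclideanSpace ℝ (Fin n) → ℂ, Measurable f → InFracDomain t f →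
      gagliardo s p f < ∞ → ∃ g, IsWeakFracLaplacian t f g ∧
        eLpNorm g (ENNReal.ofReal (n * p / (n - (s - t) * p))) volume ≤ C * gagliardo s p f := by
  have hn' : (0 : ℝ) < n := Nat.cast_pos.2 hn
  have hp0 : 0 < p := by linarith
  have hσ : 0 < (s - t) * p := mul_pos (by linarith) hp0
  have hD : 0 < n - (s - t) * p := by linarith
  set r := n * p / (n - (s - t) * p) with hr
  have hr1 : 1 < r := by
    rw [hr, one_lt_div hD]
    nlinarith
  have hr0 : 0 < r := by linarith
  obtain ⟨k, hk⟩ := exists_nat_gt t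
  have hk0 : k ≠ 0 := by rintro rfl; simp at hk; linarith
  have hk2 : t < 2 * k := by linarith
  set ψ : 𝓢(EuclideanSpace ℝ (Fin n), ℂ) :=
    𝓕⁻ (mulNormSqPow k (annulus (EuclideanSpace ℝ (Fin n)))) with hψ
  have hψ0 : ∫ z, ψ z = 0 := integral_fourierInv_mulNormSqPow hk0 _
  obtain ⟨C, hC⟩ := exists_lintegral_scales_rpow_le hψ0 ht hst hp
    (by rwa [finrank_euclideanSpace_fin])
  simp only [finrank_euclideanSpace_fin] at hC
  rw [← hr] at hC
  set κ : ℂ := (((2 * π) ^ t / calderonConst k t : ℝ) : ℂ) with hκ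
  refine ⟨‖κ‖₊ * C ^ (1 / r), fun f hf hfw hfin => ?_⟩
  have hi : ∀ u y, Integrable (fun x => f x * dilate ψ u (x - y)) :=
    fun u y => integrable_mul_dilate hf hfw ψ u y
  set I := ∫⁻ y, gagliardoDensity s p f y with hI
  have hIfin : I ≠ ∞ := by
    intro h
    rw [gagliardo_eq, ← hI, h, ENNReal.top_rpow_of_pos (by positivity)] at hfin
    exact lt_irrefl _ hfin
  have hA := stronglyMeasurable_dilateAvg hf ψ
  set T : EuclideanSpace ℝ (Fin n) → ℝ≥0∞ := fun y =>
    ∫⁻ u, ENNReal.ofReal (exp (-t * u)) * ‖dilateAvg ψ f u y‖ₑ with hT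
  have hTm : Measurable T := by
    refine Measurable.lintegral_prod_left' (f := fun q : ℝ × EuclideanSpace ℝ (Fin n) =>
      ENNReal.ofReal (exp (-t * q.1)) * ‖dilateAvg ψ f q.1 q.2‖ₑ) ?_
    have := hA.measurable
    fun_prop
  have hTr : ∫⁻ y, T y ^ r ≤ C * I ^ ((n : ℝ) / (n - (s - t) * p)) := hC f hf hi
  have hTfin : ∫⁻ y, T y ^ r ≠ ∞ :=
    ne_top_of_le_ne_top (ENNReal.mul_ne_top ENNReal.coe_ne_top
      (ENNReal.rpow_ne_top_of_nonneg (by positivity) hIfin)) hTr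
  set g : EuclideanSpace ℝ (Fin n) → ℂ := fun y =>
    κ * ∫ u : ℝ, ((exp (-t * u) : ℝ) : ℂ) * dilateAvg ψ f u y with hg
  have hgm : StronglyMeasurable g := by
    refine StronglyMeasurable.const_mul ?_ κ
    refine StronglyMeasurable.integral_prod_left (f := fun (u : ℝ) (y : EuclideanSpace ℝ (Fin n)) =>
      ((exp (-t * u) : ℝ) : ℂ) * dilateAvg ψ f u y) ?_
    exact (Continuous.stronglyMeasurable (by fun_prop)).mul hA
  have hgT : ∀ y, ‖g y‖ₑ ≤ ‖κ‖ₑ * T y := fun y => by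
    simp only [hg, hT, enorm_mul κ, ← enorm_exp_mul]
    gcongr
    exact enorm_integral_le_lintegral_enorm _
  have hnorm : eLpNorm g (ENNReal.ofReal r) volume ≤
      (‖κ‖₊ * C ^ (1 / r) : ℝ≥0) * gagliardo s p f := by
    rw [eLpNorm_eq_lintegral_rpow_enorm_toReal (by simpa using hr0) ENNReal.ofReal_ne_top,
      ENNReal.toReal_ofReal hr0.le, gagliardo_eq, ← hI]
    calc _ ≤ (∫⁻ y, (‖κ‖ₑ * T y) ^ r) ^ (1 / r) := by
          gcongr with y
          exact hgT y
      _ = ‖κ‖ₑ * (∫⁻ y, T y ^ r) ^ (1 / r) := by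
          simp only [ENNReal.mul_rpow_of_nonneg _ _ hr0.le]
          rw [lintegral_const_mul' _ _ (by finiteness),
            ENNReal.mul_rpow_of_nonneg _ _ (by positivity), ← ENNReal.rpow_mul,
            mul_one_div_cancel hr0.ne', ENNReal.rpow_one]
      _ ≤ ‖κ‖ₑ * (C * I ^ ((n : ℝ) / (n - (s - t) * p))) ^ (1 / r) := by gcongr
      _ = _ := by
          rw [ENNReal.mul_rpow_of_nonneg _ _ (by positivity), ← ENNReal.rpow_mul,
            show (n : ℝ) / (n - (s - t) * p) * (1 / r) = 1 / p by rw [hr]; field_simp,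
            ENNReal.coe_mul, ENNReal.coe_rpow_of_nonneg _ (by positivity), mul_assoc]
          rfl
  have hgLp : MemLp g (ENNReal.ofReal r) volume :=
    ⟨hgm.aestronglyMeasurable, hnorm.trans_lt (ENNReal.mul_lt_top ENNReal.coe_lt_top hfin)⟩
  refine ⟨g, ⟨hgLp.locallyIntegrable (ENNReal.one_le_ofReal.2 hr1.le), fun φ => ?_⟩, hnorm⟩
  obtain ⟨C', hC'⟩ := exists_lintegral_exp_mul_integral_dilate_le ht hk2
    (by rwa [finrank_euclideanSpace_fin]) φ
  rw [← hψ, finrank_euclideanSpace_fin] at hC'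
  have hTφ : ∫⁻ y, T y * ‖φ y‖ₑ ≠ ∞ := by
    have hrq := Real.HolderConjugate.conjExponent hr1
    have hq0 := hrq.symm.pos
    have h1 := φ.memLp (ENNReal.ofReal r.conjExponent) volume
    have h2 := h1.2
    rw [eLpNorm_eq_lintegral_rpow_enorm_toReal (by simpa using hq0) ENNReal.ofReal_ne_top,
      ENNReal.toReal_ofReal hq0.le] at h2
    refine ne_top_of_le_ne_top ?_ (ENNReal.lintegral_mul_le_Lp_mul_Lq volume hrq
      hTm.aemeasurable φ.continuous.measurable.enorm.aemeasurable)
    exact ENNReal.mul_ne_top (ENNReal.rpow_ne_top_of_nonneg (by positivity) hTfin) h2.ne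
  obtain ⟨e1, e2, e3⟩ := integral_mul_integral_scales hf hfw ψ φ hC' hTφ
  simp only [fracLaplacian_eq hn k ht, ← hψ, ← hκ, hg, mul_left_comm (f _) κ, mul_assoc κ,
    integral_const_mul]
  exact ⟨e1.const_mul κ, e2.const_mul κ, by rw [e3]⟩

end Final

end FractionalSobolev

theorem theorem8p2 (n : ℕ) (s t p : ℝ) (ht : 0 ≤ t) (hst : t < s)
    (hp : 1 < p) (hpn : p < (n : ℝ) / (s - t)) :
    ∃ C : ℝ≥0,
      (∀ f : 𝓢(EuclideanSpace ℝ (Fin n), ℂ),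
        eLpNorm (fracLaplacian t f) (ENNReal.ofReal (n * p / (n - (s - t) * p))) volume
          ≤ C * gagliardo s p f) ∧
      (∀ f : EuclideanSpace ℝ (Fin n) → ℂ, InFracDomain t f → gagliardo s p f < ∞ →
        ∃ g : EuclideanSpace ℝ (Fin n) → ℂ, IsWeakFracLaplacian t f g ∧
          eLpNorm g (ENNReal.ofReal (n * p / (n - (s - t) * p))) volume
            ≤ C * gagliardo s p f) := by
  have hpn' : (s - t) * p < n := by
    rwa [lt_div_iff₀ (by linarith), mul_comm] at hpn
  have hn : 0 < n := by
    have : (0 : ℝ) < n := lt_trans (mul_pos (by linarith) (by linarith)) hpn'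
    exact_mod_cast this
  obtain ⟨C, hC⟩ := exists_isWeakFracLaplacian_of_measurable hn ht hst hp hpn'
  have key : ∀ f : EuclideanSpace ℝ (Fin n) → ℂ, InFracDomain t f → gagliardo s p f < ∞ →
        ∃ g : EuclideanSpace ℝ (Fin n) → ℂ, IsWeakFracLaplacian t f g ∧
          eLpNorm g (ENNReal.ofReal (n * p / (n - (s - t) * p))) volume
            ≤ (C + 1 : ℝ≥0) * gagliardo s p f := fun f hf hfin => by
    have hm := hf.aestronglyMeasurable
    have hae := hm.ae_eq_mk
    obtain ⟨g, hg, hgn⟩ := hC (hm.mk f) hm.stronglyMeasurable_mk.measurable (hf.congr hae)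
      (by rwa [← gagliardo_congr hae])
    refine ⟨g, hg.congr hae.symm, hgn.trans ?_⟩
    rw [gagliardo_congr hae]
    gcongr
    simp
  -- The constant `C + 1` is positive, so that (i) is trivial when the seminorm is infinite.
  refine ⟨C + 1, fun f => ?_, key⟩
  rcases eq_or_ne (gagliardo s p f) ∞ with h | h
  · rw [h, ENNReal.mul_top (by simp)]
    exact le_top
  · obtain ⟨g, hg, hgn⟩ := key f (inFracDomain_schwartz ht f) (lt_top_iff_ne_top.2 h)
    rwa [eLpNorm_congr_ae (hg.ae_eq_fracLaplacian ht)]
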